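/- Fix $\beta\in(0,\infty)$. The linear reliability channel (LRC) with parameter $\beta$ maps a binary input $x\in\{0,1\}^n$ to a binary output as follows: given a permutation $\tau\in S_n$ (the reliability ordering), the bits are flipped independently, the $i$-th one with probability $q_{\tau(i)}$, where $q_j=\dfrac{e^{-\beta j/n}}{1+e^{-\beta j/n}}$; the permutation is uniformly distributed on $S_n$. The noise effect is the modulo-2 sum of input and output. The soft-decision noise effect $N^n$ has the conditional law of the noise effect given the permutation $\tau=\tau_n$ (for any choice of $\tau_n\in S_n$), and the hard-decision noise effect $Z^n$ has its unconditional law, obtained by averaging over $S_n$. For $A\in\{N,Z\}$ let $G_A:\{0,1\}^n\to\{1,\dots,2^n\}$ be an optimal guessing function, that is, a bijection which orders the sequences by non-increasing probability under the law of $A^n$. Let $$\Lambda_A(\alpha)=\lim_{n\to\infty}\frac1n\ln\mathbb E\bigl[e^{\alpha\ln G_A(A^n)}\bigr]\qquad(\alpha\in\mathbb R)$$ be the scaled cumulant generating function of the guesswork process $n^{-1}\ln G_A(A^n)$, let $$I_A(x)=\sup_{\alpha\in\mathbb R}\{x\alpha-\Lambda_A(\alpha)\}$$ be its rate function, and let $I_{A,2}(x)=\frac1{\ln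 2}I_A(x\ln 2)$ be the rate function in bits. The limits $\Lambda_N(\alpha)$ and $\Lambda_Z(\alpha)$ exist and are finite for all $\alpha\in\mathbb R$, and $I_N$, $I_Z$ are finite on $[0,\ln 2]$. There exist a unique $x^*\in(0,1)$ and a unique $y^*\in(0,1)$ at which $I_{N,2}$ and $I_{Z,2}$ respectively are differentiable with $$I_{N,2}'(x^*)=1,\qquad I_{Z,2}'(y^*)=1 .$$ Furthermore, the critical rates $1-y^*$ (hard-decision) and $1-x^*$ (soft-decision) satisfy $1-y^*<1-x^*$. -/

import Mathlib

noncomputable section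

namespace LRC

/-- Bit-flip probability of the position of reliability rank `i` (where `i = 1, …, n`) in the
linear reliability channel with noise parameter `β` and block length `n`. -/
def flipProb (β : ℝ) (n i : ℕ) : ℝ :=
  Real.exp (-β * i / n) / (1 + Real.exp (-β * i / n))

/-- Transition probability of the linear reliability channel, given that the reliability ordering
permutation is `τ`: the bit `x i` is flipped with the probability `flipProb β n (τ i)`,
independently of the others. The indices `0, …, n - 1` of `Fin n` stand for `1, …, n`. -/
def channelProb (β : ℝ) {n : ℕ} (τ : Equiv.Perm (Fin n)) (x y : Fin n → Bool) : ℝ :=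
  ∏ i, if y i = x i then 1 - flipProb β n ((τ i : ℕ) + 1) else flipProb β n ((τ i : ℕ) + 1)

/-- Mass function of the soft-decision noise effect: the law of the sum modulo 2 of channel input
and channel output, given the reliability ordering permutation `τ`. By
`channelProb_xor` it does not depend on the input, so it is read off at the zero input. -/
def softNoise (β : ℝ) {n : ℕ} (τ : Equiv.Perm (Fin n)) (z : Fin n → Bool) : ℝ :=
  channelProb β τ (fun _ => false) z

theorem channelProb_xor (β : ℝ) {n : ℕ} (τ : Equiv.Perm (Fin n)) (x z : Fin n → Bool) :
    channelProb β τ x (fun i => xor (x i) (z i)) = softNoise β τ z := by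
  unfold softNoise channelProb
  refine Finset.prod_congr rfl fun i _ => ?_
  have h : ((x i ^^ z i) = x i) = (z i = false) := by cases x i <;> cases z i <;> simp
  simp only [h]

/-- Mass function of the hard-decision noise effect: the permutation is uniformly distributed
and not known to the decoder. -/
def hardNoise (β : ℝ) {n : ℕ} (z : Fin n → Bool) : ℝ :=
  (∑ τ : Equiv.Perm (Fin n), softNoise β τ z) / (Nat.factorial n : ℝ)

/-- `G` is an optimal guessing function for the mass function `p`: a bijection of the binary
sequences of length `n` onto `{1, …, 2 ^ n}` that lists them in an order of non-increasing
probability. -/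
def IsOptimalGuessing {n : ℕ} (p : (Fin n → Bool) → ℝ) (G : (Fin n → Bool) → ℕ) : Prop :=
  Set.BijOn G Set.univ (Set.Icc 1 (2 ^ n)) ∧ ∀ x₁ x₂, p x₂ < p x₁ → G x₁ < G x₂

/-- `Λ` is the scaled cumulant generating function of the process `A n` (where `A n` is a function
of a random sequence with the mass function `p n`): for every real `α`,
`(1 / n) * log 𝔼[exp (α * n * A n)]` converges to `Λ α`. -/
def IsSCGF (p A : (n : ℕ) → (Fin n → Bool) → ℝ) (Λ : ℝ → ℝ) : Prop :=
  ∀ α : ℝ, Filter.Tendsto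
    (fun n : ℕ => (1 / (n : ℝ)) * Real.log (∑ x, p n x * Real.exp (α * n * A n x)))
    Filter.atTop (nhds (Λ α))

/-- The guesswork process `n⁻¹ * log (G n)`. -/
def guesswork (G : (n : ℕ) → (Fin n → Bool) → ℕ) (n : ℕ) (x : Fin n → Bool) : ℝ :=
  (n : ℝ)⁻¹ * Real.log (G n x)

/-- The set of which the Legendre-Fenchel transform of `Λ` at `x` is the supremum. -/
def legendreSet (Λ : ℝ → ℝ) (x : ℝ) : Set ℝ :=
  Set.range fun α : ℝ => x * α - Λ α

/-- The rate function (in nats), i.e. the Legendre-Fenchel transform of `Λ`. -/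
def rate (Λ : ℝ → ℝ) (x : ℝ) : ℝ :=
  sSup (legendreSet Λ x)

/-- The rate function in bits. -/
def rateBits (Λ : ℝ → ℝ) (x : ℝ) : ℝ :=
  (1 / Real.log 2) * rate Λ (x * Real.log 2)

end LRC

end

noncomputable section

namespace LRC

open Set Filter Topology

/-! By Legendre duality, the rate function has derivative 1 at `x` exactly when `x` is the slope of
`Λ` at `α = 1`. So `x* ln 2` and `y* ln 2` are the slopes of the two generating functions at 1, and
both turn out to be entropies. Write `h` for the binary entropy, `σ` for the sigmoid and `K_β` for
`cumulant β`.

Arikan's bounds (`abs_log_moment_sub_le`) replace the guesswork moment of order `α > -1` by `(∑ p ^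
(1/(1+α))) ^ (1+α)`, up to powers of `n + 1`. For the soft law this sum factorises over the bits,
and a Riemann sum gives `Λ_N(α) = (1+α) K_{β/(1+α)}(0) - K_β(0)`. Its slope at 1 is the mean of
`h(σ(-βu/2))` over `u` in `[0, 1]` (`softSCGF_strict_support`).

The hard law depends on the Hamming weight only. Exponential tilting at the weights near `n m`, with
`m = K_β'(θ)`, gives `Λ_Z(α) = sup_θ (K_β(θ) - θ m + α h(m)) - K_β(0)`, the supremum being replaced
by 0 if negative (`tendsto_logWeightSum`). At `α = 1` it is attained at a `θ > 0` with `K_β'(θ) =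
σ(-θ)` (`exists_balance`), and the slope is `h(σ(-θ))`.

It remains to compare two entropies. The tangent to the concave `h` at `σ(-θ)` has slope `θ > 0`, so
it suffices that the mean of `σ(-βu/2)` is below `σ(-θ)` (`cumulantDeriv_half_lt`). Both sides have
closed forms, and the claim reduces to a logarithmic inequality in `r = exp(-β/2)`
(`log_two_sub_log_one_add_lt`). -/

/-! ### Legendre duality at `α = 1` -/

lemma le_rate {Λ : ℝ → ℝ} {x : ℝ} (h : BddAbove (legendreSet Λ x)) (α : ℝ) :
    x * α - Λ α ≤ rate Λ x :=
  le_csSup h ⟨α, rfl⟩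

lemma rate_le {Λ : ℝ → ℝ} {x c : ℝ} (h : ∀ α, x * α - Λ α ≤ c) : rate Λ x ≤ c := by
  refine csSup_le (range_nonempty _) ?_
  rintro _ ⟨α, rfl⟩
  exact h α

lemma rate_eq_of_isMax {Λ : ℝ → ℝ} {x : ℝ} (h : ∀ α, x * α - Λ α ≤ x - Λ 1) :
    rate Λ x = x - Λ 1 := by
  refine le_antisymm (rate_le h) ?_
  have := le_rate (Λ := Λ) (x := x) ⟨x - Λ 1, by rintro _ ⟨α, rfl⟩; exact h α⟩ 1
  linarith

lemma convexOn_rate {Λ : ℝ → ℝ} {s : Set ℝ} (hs : Convex ℝ s)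
    (h : ∀ x ∈ s, BddAbove (legendreSet Λ x)) : ConvexOn ℝ s (rate Λ) := by
  refine ⟨hs, fun x hx y hy a b ha hb hab => rate_le fun α => ?_⟩
  have h1 := mul_le_mul_of_nonneg_left (le_rate (h x hx) α) ha
  have h2 := mul_le_mul_of_nonneg_left (le_rate (h y hy) α) hb
  have h3 : (a • x + b • y) * α - Λ α = a * (x * α - Λ α) + b * (y * α - Λ α) := by
    simp only [smul_eq_mul]
    linear_combination (Λ α) * hab
  rw [h3, smul_eq_mul, smul_eq_mul]
  linarith

/-- Outside an interval around `1`, a convex function that lies strictly above a line at the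
endpoints grows at least as fast as the corresponding secants. -/
lemma exists_secant_bounds {Λ : ℝ → ℝ} (hΛ : ConvexOn ℝ univ Λ) {x : ℝ}
    (hs : ∀ α, 0 < α → α ≠ 1 → Λ 1 + x * (α - 1) < Λ α) {ε : ℝ} (h0 : 0 < ε) (h1 : ε < 1) :
    ∃ l u, l < x ∧ x < u ∧ (∀ α, 1 + ε ≤ α → Λ 1 + u * (α - 1) ≤ Λ α) ∧
      ∀ α, α ≤ 1 - ε → Λ 1 + l * (α - 1) ≤ Λ α := by
  have hp := hs (1 + ε) (by linarith) (by linarith)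
  have hm := hs (1 - ε) (by linarith) (by linarith)
  refine ⟨(Λ (1 - ε) - Λ 1) / (1 - ε - 1), (Λ (1 + ε) - Λ 1) / (1 + ε - 1), ?_, ?_, ?_, ?_⟩
  · rw [div_lt_iff_of_neg (by linarith)]; linarith
  · rw [lt_div_iff₀ (by linarith)]; linarith
  · intro α hα
    have := hΛ.secant_mono (mem_univ 1) (mem_univ (1 + ε)) (mem_univ α) (by linarith)
      (by linarith) hα
    rw [le_div_iff₀ (by linarith)] at this
    linarith
  · intro α hα
    have := hΛ.secant_mono (mem_univ 1) (mem_univ α) (mem_univ (1 - ε)) (by linarith)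
      (by linarith) hα
    rw [div_le_iff_of_neg (by linarith)] at this
    linarith

/-- Support on the positive half-line suffices: by convexity a secant through 1 of slope less than
`x` continues the bound to `α ≤ 0`. -/
lemma isMax_of_strict_support {Λ : ℝ → ℝ} (hΛ : ConvexOn ℝ univ Λ) {x : ℝ}
    (hs : ∀ α, 0 < α → α ≠ 1 → Λ 1 + x * (α - 1) < Λ α) (α : ℝ) :
    x * α - Λ α ≤ x - Λ 1 := by
  rcases lt_or_ge 0 α with h | h
  · rcases eq_or_ne α 1 with rfl | h1
    · simp
    · linarith [hs α h h1]
  · obtain ⟨l, u, hl, -, -, h2⟩ :=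
      exists_secant_bounds hΛ hs (ε := 1 / 2) (by norm_num) (by norm_num)
    have := h2 α (by linarith)
    nlinarith

/-- Strictness forces the near-maximizers of `y * α - Λ α` towards 1 as `y → x`, so the rate at `y`
is `y - Λ 1` up to an error `c * |y - x|` with `c` arbitrarily small. -/
lemma hasDerivAt_rate_of_strict_support {Λ : ℝ → ℝ} (hΛ : ConvexOn ℝ univ Λ) {x : ℝ}
    (hs : ∀ α, 0 < α → α ≠ 1 → Λ 1 + x * (α - 1) < Λ α) : HasDerivAt (rate Λ) 1 x := by
  have hmax := isMax_of_strict_support hΛ hs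
  rw [hasDerivAt_iff_isLittleO, Asymptotics.isLittleO_iff]
  intro c hc
  -- The cap 1/2 keeps `1 - ε` positive, where the strict support is available; `c` is the error
  -- allowed for `α` within `ε` of 1.
  obtain ⟨l, u, hl, hu, h1, h2⟩ := exists_secant_bounds hΛ hs (ε := min c (1 / 2))
    (by positivity) ((min_le_right _ _).trans_lt (by norm_num))
  set ε := min c (1 / 2)
  filter_upwards [Icc_mem_nhds hl hu] with y hy
  have key : ∀ α, y * α - Λ α ≤ y - Λ 1 + c * |y - x| := by
    intro α
    have hn : 0 ≤ c * |y - x| := by positivity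
    rcases le_or_gt (1 + ε) α with h | h
    · have := h1 α h
      have h3 : 0 ≤ (u - y) * (α - 1) :=
        mul_nonneg (by linarith [hy.2]) (by have : 0 < ε := by positivity
                                            linarith)
      nlinarith
    rcases le_or_gt α (1 - ε) with h' | h'
    · have := h2 α h'
      have h3 : 0 ≤ (y - l) * (1 - α) :=
        mul_nonneg (by linarith [hy.1]) (by have : 0 < ε := by positivity
                                            linarith)
      nlinarith
    · have h3 : (α - 1) * (y - x) ≤ c * |y - x| := by
        refine (le_abs_self _).trans ?_
        rw [abs_mul]
        refine mul_le_mul_of_nonneg_right ?_ (abs_nonneg _)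
        refine le_trans ?_ (min_le_left c (1 / 2))
        exact abs_le.2 ⟨by linarith, by linarith⟩
      have := hmax α
      nlinarith
  have hub := rate_le key
  have hlb := le_rate (Λ := Λ) (x := y) ⟨_, by rintro _ ⟨α, rfl⟩; exact key α⟩ 1
  rw [rate_eq_of_isMax hmax, smul_eq_mul, mul_one, Real.norm_eq_abs, Real.norm_eq_abs, abs_le]
  have hn : 0 ≤ c * |y - x| := by positivity
  constructor <;> linarith

/-- The tangent of slope 1 at `x₁` lies below the convex rate function, which makes `α = 1` optimal
for `x₁` too. Hence `x` and `x₁` are both subgradients of `Λ` at 1, and a differentiable majorant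
`U` touching `Λ` there admits only `U'(1)`. Differentiability of `Λ` itself is thereby avoided. -/
lemma eq_of_hasDerivAt_rate {Λ U : ℝ → ℝ} {s : Set ℝ} (hs : Convex ℝ s)
    (hb : ∀ x ∈ s, BddAbove (legendreSet Λ x)) {x x₁ d : ℝ} (hx : x ∈ s) (hx₁ : x₁ ∈ s)
    (hmax : ∀ α, x * α - Λ α ≤ x - Λ 1) (hU : HasDerivAt U d 1) (hU1 : U 1 = Λ 1)
    (hΛU : ∀ α, 0 < α → Λ α ≤ U α) (h₁ : HasDerivAt (rate Λ) 1 x₁) : x₁ = x := by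
  have hc := convexOn_rate hs hb
  have h2 : rate Λ x₁ + (x - x₁) ≤ rate Λ x := by
    rcases lt_trichotomy x x₁ with h | rfl | h
    · have := hc.slope_le_of_hasDerivAt hx hx₁ h h₁
      rw [slope_def_field, div_le_iff₀ (by linarith)] at this
      linarith
    · simp
    · have := hc.le_slope_of_hasDerivAt hx₁ hx h h₁
      rw [slope_def_field, le_div_iff₀ (by linarith)] at this
      linarith
  rw [rate_eq_of_isMax hmax] at h2
  have hd : ∀ z, (∀ α, z * α - Λ α ≤ z - Λ 1) → z = d := by
    intro z hz
    have hmin : IsLocalMin (fun α => U α - z * α) 1 := by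
      filter_upwards [lt_mem_nhds (show (0 : ℝ) < 1 by norm_num)] with α hα
      have := hz α
      have := hΛU α hα
      simp only [hU1]
      linarith
    have hder : HasDerivAt (fun α => U α - z * α) (d - z * 1) 1 :=
      hU.sub ((hasDerivAt_id (1 : ℝ)).const_mul z)
    linarith [hmin.hasDerivAt_eq_zero hder]
  rw [hd x hmax, hd x₁ fun α => (le_rate (hb x₁ hx₁) α).trans (by linarith)]

lemma hasDerivAt_rateBits_iff {Λ : ℝ → ℝ} {x : ℝ} :
    HasDerivAt (rateBits Λ) 1 x ↔ HasDerivAt (rate Λ) 1 (x * Real.log 2) := by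
  have h2 : 0 < Real.log 2 := Real.log_pos (by norm_num)
  constructor
  · intro h
    have h1 : HasDerivAt (fun y : ℝ => y / Real.log 2) (1 / Real.log 2) (x * Real.log 2) :=
      (hasDerivAt_id _).div_const _
    have h3 := (HasDerivAt.comp (x * Real.log 2) (h₂ := rateBits Λ) (h₂' := 1)
      (by rwa [mul_div_cancel_right₀ _ h2.ne']) h1).const_mul (Real.log 2)
    have e : rate Λ = fun y => Real.log 2 * (rateBits Λ ∘ fun y => y / Real.log 2) y := by
      ext y
      simp only [Function.comp, rateBits]
      field_simp
    rw [e]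
    exact h3.congr_deriv (by field_simp)
  · intro h
    have h1 : HasDerivAt (fun y : ℝ => y * Real.log 2) (1 * Real.log 2) x :=
      (hasDerivAt_id _).mul_const _
    have h3 := (HasDerivAt.comp x (h₂ := rate Λ) h h1).const_mul (1 / Real.log 2)
    exact h3.congr_deriv (by field_simp)

/-! ### Moments of the optimal guesswork -/

section Guessing

variable {n : ℕ} {p : (Fin n → Bool) → ℝ} {G : (Fin n → Bool) → ℕ}

lemma IsOptimalGuessing.pos (hG : IsOptimalGuessing p G) (x : Fin n → Bool) : 0 < G x :=
  (hG.1.mapsTo (mem_univ x)).1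

lemma IsOptimalGuessing.sum_comp (hG : IsOptimalGuessing p G) (f : ℕ → ℝ) :
    ∑ x, f (G x) = ∑ k ∈ Finset.Icc 1 (2 ^ n), f k := by
  refine Finset.sum_nbij G ?_ ?_ ?_ fun _ _ => rfl
  · intro x _
    simpa using hG.1.mapsTo (mem_univ x)
  · simpa using hG.1.injOn
  · simpa using hG.1.surjOn

lemma IsOptimalGuessing.sum_inv_le (hG : IsOptimalGuessing p G) :
    ∑ x, ((G x : ℝ))⁻¹ ≤ 1 + n := by
  rw [hG.sum_comp fun k => (k : ℝ)⁻¹]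
  have h := harmonic_le_one_add_log (2 ^ n)
  rw [harmonic_eq_sum_Icc] at h
  push_cast at h
  refine h.trans ?_
  rw [Real.log_pow]
  have : Real.log 2 ≤ 1 := (Real.log_two_lt_d9.trans (by norm_num)).le
  nlinarith [(Nat.cast_nonneg n : (0 : ℝ) ≤ n)]

lemma IsOptimalGuessing.card_le (hG : IsOptimalGuessing p G) (x : Fin n → Bool) :
    (Finset.univ.filter fun y => G y ≤ G x).card = G x := by
  have h : (Finset.univ.filter fun y => G y ≤ G x).card = (Finset.Icc 1 (G x)).card := by
    refine Finset.card_nbij G ?_ ?_ ?_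
    · intro y hy
      simp only [Finset.mem_univ, true_and, Finset.coe_filter,
        mem_ofPred_eq, Finset.coe_Icc, mem_Icc] at hy ⊢
      exact ⟨hG.pos y, hy⟩
    · exact hG.1.injOn.mono (subset_univ _)
    · intro k hk
      simp only [Finset.coe_Icc, mem_Icc] at hk
      obtain ⟨y, -, hy⟩ := hG.1.surjOn (show k ∈ Icc 1 (2 ^ n) from
        ⟨hk.1, hk.2.trans (hG.1.mapsTo (mem_univ x)).2⟩)
      exact ⟨y, by simp [hy, hk.2], hy⟩
  simpa using h

lemma IsOptimalGuessing.le_of_le (hG : IsOptimalGuessing p G) {x y : Fin n → Bool}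
    (h : G y ≤ G x) : p x ≤ p y :=
  not_lt.1 fun h' => (hG.2 x y h').not_ge h

lemma IsOptimalGuessing.mul_rpow_le (hG : IsOptimalGuessing p G) (hp : ∀ x, 0 < p x) {s : ℝ}
    (hs : 0 ≤ s) (x : Fin n → Bool) : G x * p x ^ s ≤ ∑ y, p y ^ s := by
  calc (G x : ℝ) * p x ^ s = ∑ y ∈ Finset.univ.filter fun y => G y ≤ G x, p x ^ s := by
        rw [Finset.sum_const, hG.card_le, nsmul_eq_mul]
    _ ≤ ∑ y ∈ Finset.univ.filter fun y => G y ≤ G x, p y ^ s := by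
        refine Finset.sum_le_sum fun y hy => ?_
        exact Real.rpow_le_rpow (hp x).le (hG.le_of_le (by simpa using hy)) hs
    _ ≤ _ := Finset.sum_le_sum_of_subset_of_nonneg (Finset.filter_subset _ _)
        fun y _ _ => Real.rpow_nonneg (hp y).le _

/-- Arikan's bounds: the guesswork moment of order `α > -1` and the Rényi entropy of order
`1 / (1 + α)` agree up to a power of `n + 1`. -/
lemma IsOptimalGuessing.abs_log_moment_sub_le (hG : IsOptimalGuessing p G) (hp : ∀ x, 0 < p x)
    {α : ℝ} (hα : -1 < α) :
    |Real.log (∑ x, p x * (G x : ℝ) ^ α) - (1 + α) * Real.log (∑ x, p x ^ (1 / (1 + α)))| ≤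
      |α| * Real.log (1 + n) := by
  set s : ℝ := 1 / (1 + α) with hs
  have hα' : 0 < 1 + α := by linarith
  have hs0 : 0 < s := by positivity
  have hsα : s + s * α = 1 := by rw [hs]; field_simp
  set S : ℝ := ∑ x, p x ^ s with hS
  have hS0 : 0 < S := Finset.sum_pos (fun x _ => Real.rpow_pos_of_pos (hp x) _)
    Finset.univ_nonempty
  have hG0 : ∀ x, (0 : ℝ) < G x := fun x => by exact_mod_cast hG.pos x
  -- With the tilted law `Q ∝ p ^ s`, the moment is `S ^ (1 + α)` times the `Q`-mean of `r ^ α`.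
  -- Optimality gives `r ≤ 1`, since the sequences guessed no later than `x` are all at least as
  -- likely.
  set r : (Fin n → Bool) → ℝ := fun x => p x ^ s / S * G x with hr
  have hr0 : ∀ x, 0 < r x := fun x =>
    mul_pos (div_pos (Real.rpow_pos_of_pos (hp x) _) hS0) (hG0 x)
  have hr1 : ∀ x, r x ≤ 1 := fun x => by
    have := hG.mul_rpow_le hp hs0.le x
    simp only [hr]
    rw [div_mul_eq_mul_div, div_le_one hS0]
    linarith
  set Q : (Fin n → Bool) → ℝ := fun x => p x ^ s / S with hQ
  have hQ0 : ∀ x, 0 < Q x := fun x => div_pos (Real.rpow_pos_of_pos (hp x) _) hS0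
  have hQ1 : ∑ x, Q x = 1 := by
    simp only [hQ]
    rw [← Finset.sum_div, div_self hS0.ne']
  have hE : ∑ x, p x * (G x : ℝ) ^ α = S ^ (1 + α) * ∑ x, Q x * r x ^ α := by
    rw [Finset.mul_sum]
    refine Finset.sum_congr rfl fun x _ => ?_
    have hpx := hp x
    have e1 : p x = p x ^ s * (p x ^ s) ^ α := by
      rw [← Real.rpow_mul hpx.le, ← Real.rpow_add hpx, hsα, Real.rpow_one]
    simp only [hQ, hr]
    rw [Real.mul_rpow (hQ0 x).le (hG0 x).le, Real.div_rpow (Real.rpow_pos_of_pos hpx _).le hS0.le,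
      Real.rpow_add hS0, Real.rpow_one]
    have : S ^ α ≠ 0 := (Real.rpow_pos_of_pos hS0 _).ne'
    conv_lhs => rw [e1]
    field_simp
  set T : ℝ := ∑ x, Q x * r x ^ α with hT
  have hT0 : 0 < T := Finset.sum_pos
    (fun x _ => mul_pos (hQ0 x) (Real.rpow_pos_of_pos (hr0 x) _)) Finset.univ_nonempty
  have hlog : Real.log (∑ x, p x * (G x : ℝ) ^ α) - (1 + α) * Real.log S = Real.log T := by
    rw [hE, Real.log_mul (Real.rpow_pos_of_pos hS0 _).ne' hT0.ne', Real.log_rpow hS0]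
    ring
  rw [hlog]
  set H : ℝ := 1 + n with hH
  have hH0 : 0 < H := by positivity
  have hH1 : 1 ≤ H := by simp [hH]
  -- The harmonic sum `∑ 1 / G ≤ 1 + n` says that `r` is not too small on `Q`-average.
  have hQr : ∑ x, Q x * (H * r x)⁻¹ ≤ 1 := by
    have : ∀ x, Q x * (H * r x)⁻¹ = H⁻¹ * (G x : ℝ)⁻¹ := fun x => by
      have := (hQ0 x).ne'
      have := (hG0 x).ne'
      change Q x * (H * (Q x * G x))⁻¹ = _
      field_simp
    simp only [this]
    rw [← Finset.mul_sum, inv_mul_le_iff₀ hH0, mul_one]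
    exact hG.sum_inv_le
  have hHT : H ^ α * T = ∑ x, Q x * (H * r x) ^ α := by
    rw [hT, Finset.mul_sum]
    refine Finset.sum_congr rfl fun x _ => ?_
    rw [Real.mul_rpow hH0.le (hr0 x).le]
    ring
  have hlogHT : Real.log (H ^ α * T) = α * Real.log H + Real.log T := by
    rw [Real.log_mul (Real.rpow_pos_of_pos hH0 _).ne' hT0.ne', Real.log_rpow hH0]
  have hHT0 : 0 < H ^ α * T := mul_pos (Real.rpow_pos_of_pos hH0 _) hT0
  rcases le_total 0 α with h | h
  · have h1 : T ≤ 1 := by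
      rw [← hQ1]
      exact Finset.sum_le_sum fun x _ => mul_le_of_le_one_right (hQ0 x).le
        (Real.rpow_le_one (hr0 x).le (hr1 x) h)
    have h2 : 1 ≤ H ^ α * T := by
      -- Tangent bound in the variable `(H * r)⁻¹`, whose mean `hQr` controls.
      have : ∀ x, 1 - α * ((H * r x)⁻¹ - 1) ≤ (H * r x) ^ α := fun x => by
        have hy : 0 < H * r x := mul_pos hH0 (hr0 x)
        rw [Real.rpow_def_of_pos hy]
        have h3 := Real.log_le_sub_one_of_pos (inv_pos.2 hy)
        rw [Real.log_inv] at h3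
        have h4 := Real.add_one_le_exp (Real.log (H * r x) * α)
        nlinarith
      calc (1 : ℝ) ≤ (1 + α) * ∑ x, Q x - α * ∑ x, Q x * (H * r x)⁻¹ := by
            rw [hQ1]; nlinarith
        _ = ∑ x, Q x * (1 - α * ((H * r x)⁻¹ - 1)) := by
            rw [Finset.mul_sum, Finset.mul_sum, ← Finset.sum_sub_distrib]
            exact Finset.sum_congr rfl fun x _ => by ring
        _ ≤ _ := by
            rw [hHT]
            exact Finset.sum_le_sum fun x _ => mul_le_mul_of_nonneg_left (this x) (hQ0 x).le
    have h3 := Real.log_nonneg h2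
    have h4 := Real.log_nonpos hT0.le h1
    have h5 := Real.log_nonneg hH1
    rw [abs_of_nonpos h4, abs_of_nonneg h]
    linarith
  · have h1 : 1 ≤ T := by
      rw [← hQ1]
      exact Finset.sum_le_sum fun x _ => le_mul_of_one_le_right (hQ0 x).le
        (Real.one_le_rpow_of_pos_of_le_one_of_nonpos (hr0 x) (hr1 x) h)
    have h2 : H ^ α * T ≤ 1 := by
      -- Bernoulli's inequality with exponent `-α` in `[0, 1]`.
      have : ∀ x, (H * r x) ^ α ≤ 1 + (-α) * ((H * r x)⁻¹ - 1) := fun x => by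
        have hy : 0 < H * r x := mul_pos hH0 (hr0 x)
        have h3 := rpow_one_add_le_one_add_mul_self (s := (H * r x)⁻¹ - 1) (p := -α)
          (by linarith [inv_pos.2 hy]) (by linarith) (by linarith)
        rwa [add_sub_cancel, Real.inv_rpow hy.le, Real.rpow_neg hy.le, inv_inv] at h3
      calc H ^ α * T ≤ ∑ x, Q x * (1 + (-α) * ((H * r x)⁻¹ - 1)) := by
            rw [hHT]
            exact Finset.sum_le_sum fun x _ => mul_le_mul_of_nonneg_left (this x) (hQ0 x).le
        _ = (1 + α) * ∑ x, Q x - α * ∑ x, Q x * (H * r x)⁻¹ := by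
            rw [Finset.mul_sum, Finset.mul_sum, ← Finset.sum_sub_distrib]
            exact Finset.sum_congr rfl fun x _ => by ring
        _ ≤ 1 := by rw [hQ1]; nlinarith
    have h3 := Real.log_nonpos hHT0.le h2
    have h4 := Real.log_nonneg h1
    rw [abs_of_nonneg h4, abs_of_nonpos h]
    linarith

/-- For `α ≤ -1` the first guess alone decides the moment: `G ^ α ≤ G⁻¹`, whose sum is only `1 + n`.
-/
lemma IsOptimalGuessing.abs_log_moment_sub_log_max_le (hG : IsOptimalGuessing p G)
    (hp : ∀ x, 0 < p x) {α : ℝ} (hα : α ≤ -1) {z : Fin n → Bool} (hz : ∀ x, p x ≤ p z) :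
    |Real.log (∑ x, p x * (G x : ℝ) ^ α) - Real.log (p z)| ≤ Real.log (1 + n) := by
  have hG0 : ∀ x, (0 : ℝ) < G x := fun x => by exact_mod_cast hG.pos x
  have hG1 : ∀ x, (1 : ℝ) ≤ G x := fun x => by exact_mod_cast hG.pos x
  have hnn : ∀ x, 0 ≤ p x * (G x : ℝ) ^ α := fun x =>
    mul_nonneg (hp x).le (Real.rpow_nonneg (hG0 x).le _)
  obtain ⟨x₀, -, hx₀⟩ := hG.1.surjOn (show 1 ∈ Icc 1 (2 ^ n) from ⟨le_rfl, Nat.one_le_two_pow⟩)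
  have h1 : p z ≤ ∑ x, p x * (G x : ℝ) ^ α := by
    refine (hG.le_of_le (by rw [hx₀]; exact hG.pos z)).trans ?_
    refine le_trans ?_ (Finset.single_le_sum (fun x _ => hnn x) (Finset.mem_univ x₀))
    simp [hx₀]
  have h2 : ∑ x, p x * (G x : ℝ) ^ α ≤ p z * (1 + n) := by
    calc ∑ x, p x * (G x : ℝ) ^ α ≤ ∑ x, p z * (G x : ℝ)⁻¹ := by
          refine Finset.sum_le_sum fun x _ => mul_le_mul (hz x) ?_
            (Real.rpow_nonneg (hG0 x).le _) (hp z).le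
          rw [← Real.rpow_neg_one]
          exact Real.rpow_le_rpow_of_exponent_le (hG1 x) hα
      _ ≤ _ := by
          rw [← Finset.mul_sum]
          exact mul_le_mul_of_nonneg_left hG.sum_inv_le (hp z).le
  have h3 := Real.log_le_log (hp z) h1
  have h4 := Real.log_le_log ((hp z).trans_le h1) h2
  rw [Real.log_mul (hp z).ne' (by positivity)] at h4
  rw [abs_of_nonneg (by linarith)]
  linarith

lemma sum_exp_eq_moment {G : (n : ℕ) → (Fin n → Bool) → ℕ} {n : ℕ} (hn : n ≠ 0)
    {p : (Fin n → Bool) → ℝ} (hG : IsOptimalGuessing p (G n)) (α : ℝ) :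
    ∑ x, p x * Real.exp (α * n * guesswork G n x) = ∑ x, p x * (G n x : ℝ) ^ α := by
  refine Finset.sum_congr rfl fun x _ => ?_
  have h0 : (0 : ℝ) < G n x := by exact_mod_cast hG.pos x
  have h1 : (n : ℝ) ≠ 0 := by exact_mod_cast hn
  rw [Real.rpow_def_of_pos h0, guesswork]
  congr 2
  field_simp

end Guessing

/-! ### Scaled cumulant generating functions: existence, convexity, finite rate -/

lemma tendsto_log_one_add_div (c : ℝ) :
    Tendsto (fun n : ℕ => 1 / (n : ℝ) * (c * Real.log (1 + n))) atTop (𝓝 0) := by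
  have h1 : Tendsto (fun x : ℝ => Real.log x / x) atTop (𝓝 0) :=
    Real.isLittleO_log_id_atTop.tendsto_div_nhds_zero
  have h2 : Tendsto (fun n : ℕ => (1 : ℝ) + n) atTop atTop :=
    tendsto_atTop_add_const_left _ _ tendsto_natCast_atTop_atTop
  have h3 : Tendsto (fun n : ℕ => 1 + 1 / (n : ℝ)) atTop (𝓝 (1 + 0)) :=
    tendsto_const_nhds.add tendsto_one_div_atTop_nhds_zero_nat
  have h4 := ((h1.comp h2).mul h3).const_mul c
  simp only [zero_mul, mul_zero] at h4
  refine h4.congr' ?_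
  filter_upwards [eventually_ne_atTop 0] with n hn
  have h5 : (n : ℝ) ≠ 0 := by exact_mod_cast hn
  have h6 : (1 : ℝ) + n ≠ 0 := by positivity
  simp only [Function.comp]
  field_simp
  ring

lemma tendsto_of_abs_sub_le {a b e : ℕ → ℝ} {l : ℝ}
    (hb : Tendsto (fun n : ℕ => 1 / (n : ℝ) * b n) atTop (𝓝 l))
    (he : Tendsto (fun n : ℕ => 1 / (n : ℝ) * e n) atTop (𝓝 0))
    (h : ∀ᶠ n in atTop, |a n - b n| ≤ e n) :
    Tendsto (fun n : ℕ => 1 / (n : ℝ) * a n) atTop (𝓝 l) := by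
  have h1 : Tendsto (fun n : ℕ => 1 / (n : ℝ) * (a n - b n)) atTop (𝓝 0) := by
    refine squeeze_zero_norm' ?_ he
    filter_upwards [h] with n hn
    rw [Real.norm_eq_abs, abs_mul, abs_of_nonneg (by positivity : (0 : ℝ) ≤ 1 / (n : ℝ))]
    exact mul_le_mul_of_nonneg_left hn (by positivity)
  have h2 := hb.add h1
  rw [add_zero] at h2
  exact h2.congr fun n => by ring

lemma isSCGF_guesswork {p : (n : ℕ) → (Fin n → Bool) → ℝ} {G : (n : ℕ) → (Fin n → Bool) → ℕ}
    (hG : ∀ n, IsOptimalGuessing (p n) (G n)) (hp : ∀ n x, 0 < p n x) {Λ : ℝ → ℝ}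
    (h1 : ∀ α, -1 < α → Tendsto
      (fun n : ℕ => 1 / (n : ℝ) * ((1 + α) * Real.log (∑ x, p n x ^ (1 / (1 + α)))))
      atTop (𝓝 (Λ α)))
    {z : (n : ℕ) → (Fin n → Bool)} (hz : ∀ n x, p n x ≤ p n (z n))
    (h2 : ∀ α, α ≤ -1 → Tendsto (fun n : ℕ => 1 / (n : ℝ) * Real.log (p n (z n)))
      atTop (𝓝 (Λ α))) :
    IsSCGF p (guesswork G) Λ := by
  intro α
  rcases lt_or_ge (-1) α with h | h
  · refine tendsto_of_abs_sub_le (h1 α h) (tendsto_log_one_add_div |α|) ?_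
    filter_upwards [eventually_ne_atTop 0] with n hn
    rw [sum_exp_eq_moment hn (hG n)]
    exact (hG n).abs_log_moment_sub_le (hp n) h
  · refine tendsto_of_abs_sub_le (h2 α h) (tendsto_log_one_add_div 1) ?_
    filter_upwards [eventually_ne_atTop 0] with n hn
    rw [sum_exp_eq_moment hn (hG n), one_mul]
    exact (hG n).abs_log_moment_sub_log_max_le (hp n) h (hz n)

/-- Hölder's inequality, obtained from the weighted AM-GM inequality applied to the normalized
terms. -/
lemma convexOn_log_sum_exp {ι : Type*} [Fintype ι] [Nonempty ι] {p : ι → ℝ} (hp : ∀ i, 0 < p i)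
    (y : ι → ℝ) : ConvexOn ℝ univ fun α : ℝ => Real.log (∑ i, p i * Real.exp (α * y i)) := by
  refine ⟨convex_univ, fun α _ γ _ a b ha hb hab => ?_⟩
  have hpos : ∀ δ : ℝ, 0 < ∑ i, p i * Real.exp (δ * y i) := fun δ =>
    Finset.sum_pos (fun i _ => mul_pos (hp i) (Real.exp_pos _)) Finset.univ_nonempty
  set A := ∑ i, p i * Real.exp (α * y i) with hA
  set C := ∑ i, p i * Real.exp (γ * y i) with hC
  have hA0 : 0 < A := hpos α
  have hC0 : 0 < C := hpos γ
  have key : ∀ i, p i * Real.exp ((a • α + b • γ) * y i) ≤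
      A ^ a * C ^ b * (a * (p i * Real.exp (α * y i) / A) + b * (p i * Real.exp (γ * y i) / C)) := by
    intro i
    have h1 := Real.geom_mean_le_arith_mean2_weighted ha hb
      (div_nonneg (mul_nonneg (hp i).le (Real.exp_pos (α * y i)).le) hA0.le)
      (div_nonneg (mul_nonneg (hp i).le (Real.exp_pos (γ * y i)).le) hC0.le) hab
    refine le_trans (le_of_eq ?_) (mul_le_mul_of_nonneg_left h1 (by positivity))
    rw [Real.div_rpow (mul_nonneg (hp i).le (Real.exp_pos _).le) hA0.le,
      Real.div_rpow (mul_nonneg (hp i).le (Real.exp_pos _).le) hC0.le,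
      Real.mul_rpow (hp i).le (Real.exp_pos _).le, Real.mul_rpow (hp i).le (Real.exp_pos _).le,
      ← Real.exp_mul, ← Real.exp_mul]
    have e1 : p i = p i ^ a * p i ^ b := by rw [← Real.rpow_add (hp i), hab, Real.rpow_one]
    have e2 : Real.exp ((a • α + b • γ) * y i) =
        Real.exp (α * y i * a) * Real.exp (γ * y i * b) := by
      rw [← Real.exp_add]; simp only [smul_eq_mul]; ring_nf
    have h3 : A ^ a ≠ 0 := (Real.rpow_pos_of_pos hA0 _).ne'
    have h4 : C ^ b ≠ 0 := (Real.rpow_pos_of_pos hC0 _).ne'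
    rw [e2]
    conv_lhs => rw [e1]
    field_simp
  have hsum : ∑ i, p i * Real.exp ((a • α + b • γ) * y i) ≤ A ^ a * C ^ b := by
    refine (Finset.sum_le_sum fun i _ => key i).trans (le_of_eq ?_)
    rw [← Finset.mul_sum, Finset.sum_add_distrib, ← Finset.mul_sum, ← Finset.mul_sum,
      ← Finset.sum_div, ← Finset.sum_div, ← hA, ← hC, div_self hA0.ne', div_self hC0.ne', mul_one,
      mul_one, hab, mul_one]
  have := Real.log_le_log (hpos _) hsum
  rwa [Real.log_mul (Real.rpow_pos_of_pos hA0 _).ne' (Real.rpow_pos_of_pos hC0 _).ne',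
    Real.log_rpow hA0, Real.log_rpow hC0] at this

lemma IsSCGF.convexOn {p A : (n : ℕ) → (Fin n → Bool) → ℝ} {Λ : ℝ → ℝ} (h : IsSCGF p A Λ)
    (hp : ∀ n x, 0 < p n x) : ConvexOn ℝ univ Λ := by
  refine ⟨convex_univ, fun α _ γ _ a b ha hb hab => ?_⟩
  refine le_of_tendsto_of_tendsto' (h (a • α + b • γ))
    (((h α).const_smul a).add ((h γ).const_smul b)) fun n : ℕ => ?_
  have := (convexOn_log_sum_exp (hp n) fun x => (n : ℝ) * A n x).2 (mem_univ α) (mem_univ γ) ha hb hab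
  simp only [← mul_assoc] at this
  refine (mul_le_mul_of_nonneg_left this (by positivity : (0 : ℝ) ≤ 1 / (n : ℝ))).trans
    (le_of_eq ?_)
  simp only [smul_eq_mul]
  ring

/-- Keeping only the first or only the last guess in the expectation gives `Λ α ≥ -C` and `Λ α ≥ α *
log 2 - C`. These dominate `x * α - C` for `α ≤ 0` and `α ≥ 0` respectively. -/
lemma IsSCGF.bddAbove_legendreSet {p : (n : ℕ) → (Fin n → Bool) → ℝ}
    {G : (n : ℕ) → (Fin n → Bool) → ℕ} {Λ : ℝ → ℝ} (h : IsSCGF p (guesswork G) Λ)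
    (hG : ∀ n, IsOptimalGuessing (p n) (G n)) {C : ℝ} (hp : ∀ (n : ℕ) x, Real.exp (-(n * C)) ≤ p n x)
    {x : ℝ} (hx : x ∈ Icc (0 : ℝ) (Real.log 2)) : BddAbove (legendreSet Λ x) := by
  have key : ∀ α v : ℝ, (∀ n : ℕ, ∃ z, Real.log (G n z) = n * v) → α * v - C ≤ Λ α := by
    intro α v hv
    refine ge_of_tendsto (h α) ?_
    filter_upwards [eventually_ne_atTop 0] with n hn
    have hn' : (0 : ℝ) < n := by positivity
    obtain ⟨z, hz⟩ := hv n
    rw [one_div, le_inv_mul_iff₀ hn', ← Real.log_exp (n * (α * v - C))]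
    refine Real.log_le_log (Real.exp_pos _) ?_
    have h0 : ∀ x, 0 ≤ p n x * Real.exp (α * n * guesswork G n x) := fun x =>
      mul_nonneg ((Real.exp_pos _).le.trans (hp n x)) (Real.exp_pos _).le
    refine le_trans ?_ (Finset.single_le_sum (fun x _ => h0 x) (Finset.mem_univ z))
    refine le_trans (le_of_eq ?_) (mul_le_mul_of_nonneg_right (hp n z) (Real.exp_pos _).le)
    rw [← Real.exp_add, guesswork, hz]
    congr 1
    field_simp
    ring
  have h1 : ∀ α, -C ≤ Λ α := fun α => by
    have := key α 0 fun n => by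
      obtain ⟨z, -, hz⟩ := (hG n).1.surjOn
        (show 1 ∈ Icc 1 (2 ^ n) from ⟨le_rfl, Nat.one_le_two_pow⟩)
      exact ⟨z, by simp [hz]⟩
    linarith
  have h2 : ∀ α, α * Real.log 2 - C ≤ Λ α := fun α => key α _ fun n => by
    obtain ⟨z, -, hz⟩ := (hG n).1.surjOn
      (show 2 ^ n ∈ Icc 1 (2 ^ n) from ⟨Nat.one_le_two_pow, le_rfl⟩)
    exact ⟨z, by simp [hz]⟩
  refine ⟨C, ?_⟩
  rintro _ ⟨α, rfl⟩
  rcases le_total 0 α with h | h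
  · nlinarith [h2 α, hx.2]
  · nlinarith [h1 α, hx.1]

/-! ### Softplus, sigmoid and entropy -/

/-- The cumulant generating function `v ↦ log (1 + exp v)` of an unnormalized Bernoulli
variable. -/
def softplus (v : ℝ) : ℝ := Real.log (1 + Real.exp v)

lemma one_add_exp_pos (v : ℝ) : 0 < 1 + Real.exp v := by positivity

lemma exp_softplus (v : ℝ) : Real.exp (softplus v) = 1 + Real.exp v :=
  Real.exp_log (one_add_exp_pos v)

lemma softplus_pos (v : ℝ) : 0 < softplus v :=
  Real.log_pos (by linarith [Real.exp_pos v])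

lemma softplus_zero : softplus 0 = Real.log 2 := by norm_num [softplus]

lemma sigmoid_eq (v : ℝ) : Real.sigmoid v = Real.exp v / (1 + Real.exp v) := by
  rw [Real.sigmoid_def, Real.exp_neg]
  have := Real.exp_pos v
  field_simp
  ring

lemma softplus_neg (v : ℝ) : softplus (-v) = softplus v - v := by
  have : 1 + Real.exp (-v) = (1 + Real.exp v) * Real.exp (-v) := by
    rw [add_mul, ← Real.exp_add]; simp; ring
  rw [softplus, this, Real.log_mul (one_add_exp_pos v).ne' (Real.exp_pos _).ne', Real.log_exp,
    softplus]
  ring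

lemma continuous_softplus : Continuous softplus :=
  Continuous.log (by fun_prop) fun v => (one_add_exp_pos v).ne'

lemma hasDerivAt_softplus (v : ℝ) : HasDerivAt softplus (Real.sigmoid v) v := by
  rw [sigmoid_eq]
  exact ((Real.hasDerivAt_exp v).const_add 1).log (one_add_exp_pos v).ne'

lemma softplus_mono : Monotone softplus := fun v w h =>
  Real.log_le_log (one_add_exp_pos v) (by gcongr)

/-- Strict Jensen inequality for `exp` at the points `0` and `w - v` with weights `1 - σ(v)` and
`σ(v)`. -/
lemma softplus_tangent_lt {v w : ℝ} (h : w ≠ v) :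
    softplus v + Real.sigmoid v * (w - v) < softplus w := by
  have h1 := strictConvexOn_exp.2 (mem_univ (0 : ℝ)) (mem_univ (w - v))
    (Ne.symm (sub_ne_zero.2 h)) (by linarith [Real.sigmoid_lt_one v] : 0 < 1 - Real.sigmoid v)
    (Real.sigmoid_pos v) (by ring)
  simp only [smul_eq_mul, mul_zero, zero_add, Real.exp_zero, mul_one] at h1
  rw [← Real.exp_lt_exp, Real.exp_add, exp_softplus, exp_softplus]
  have h2 : (1 + Real.exp v) * (1 - Real.sigmoid v + Real.sigmoid v * Real.exp (w - v)) =
      1 + Real.exp w := by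
    have := Real.exp_pos v
    rw [sigmoid_eq, Real.exp_sub]
    field_simp
    ring
  rw [← h2]
  exact mul_lt_mul_of_pos_left h1 (one_add_exp_pos v)

lemma softplus_tangent_le (v w : ℝ) : softplus v + Real.sigmoid v * (w - v) ≤ softplus w := by
  rcases eq_or_ne w v with rfl | h
  · simp
  · exact (softplus_tangent_lt h).le

lemma log_sigmoid (v : ℝ) : Real.log (Real.sigmoid v) = v - softplus v := by
  rw [sigmoid_eq, Real.log_div (Real.exp_pos _).ne' (one_add_exp_pos v).ne', Real.log_exp,
    softplus]

lemma log_one_sub_sigmoid (v : ℝ) : Real.log (1 - Real.sigmoid v) = -softplus v := by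
  rw [← Real.sigmoid_neg, log_sigmoid, softplus_neg]
  ring

/-- The entropy is the Legendre dual of softplus, so every tangent inequality for softplus becomes
an entropy bound. -/
lemma binEntropy_sigmoid (v : ℝ) :
    Real.binEntropy (Real.sigmoid v) = softplus v - v * Real.sigmoid v := by
  rw [Real.binEntropy, Real.log_inv, Real.log_inv, log_sigmoid, log_one_sub_sigmoid]
  ring

/-! ### The limiting cumulant and its derivative -/

/-- The limit of `n⁻¹ * log (∏ i, (1 + exp (θ - β * i / n)))`. -/
def cumulant (β θ : ℝ) : ℝ := ∫ u in (0 : ℝ)..1, softplus (θ - β * u)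

/-- The derivative of `cumulant β`. -/
def cumulantDeriv (β θ : ℝ) : ℝ := ∫ u in (0 : ℝ)..1, Real.sigmoid (θ - β * u)

lemma intervalIntegrable_softplus (β θ a b : ℝ) :
    IntervalIntegrable (fun u => softplus (θ - β * u)) MeasureTheory.volume a b :=
  (continuous_softplus.comp (by fun_prop)).intervalIntegrable a b

lemma intervalIntegrable_sigmoid (β θ a b : ℝ) :
    IntervalIntegrable (fun u => Real.sigmoid (θ - β * u)) MeasureTheory.volume a b :=
  (continuous_sigmoid.comp (by fun_prop)).intervalIntegrable a b

lemma mul_cumulantDeriv (β θ : ℝ) : β * cumulantDeriv β θ = softplus θ - softplus (θ - β) := by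
  have h : ∀ u ∈ uIcc (0 : ℝ) 1, HasDerivAt (fun u => -softplus (θ - β * u))
      (β * Real.sigmoid (θ - β * u)) u := by
    intro u _
    have h1 : HasDerivAt (fun u : ℝ => θ - β * u) (-(β * 1)) u :=
      ((hasDerivAt_id u).const_mul β).const_sub θ
    have h2 := ((hasDerivAt_softplus (θ - β * u)).comp u h1).neg
    exact h2.congr_deriv (by ring)
  rw [cumulantDeriv, ← intervalIntegral.integral_const_mul,
    intervalIntegral.integral_eq_sub_of_hasDerivAt h
      ((intervalIntegrable_sigmoid β θ 0 1).const_mul β)]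
  simp
  ring

lemma cumulant_tangent_le (β θ η : ℝ) :
    cumulant β θ + cumulantDeriv β θ * (η - θ) ≤ cumulant β η := by
  rw [cumulant, cumulant, cumulantDeriv, ← intervalIntegral.integral_mul_const,
    ← intervalIntegral.integral_add (intervalIntegrable_softplus β θ 0 1)
      ((intervalIntegrable_sigmoid β θ 0 1).mul_const _)]
  refine intervalIntegral.integral_mono_on zero_le_one
    ((intervalIntegrable_softplus β θ 0 1).add ((intervalIntegrable_sigmoid β θ 0 1).mul_const _))
    (intervalIntegrable_softplus β η 0 1) fun u _ => ?_
  have := softplus_tangent_le (θ - β * u) (η - β * u)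
  rwa [sub_sub_sub_cancel_right] at this

lemma cumulantDeriv_le {β : ℝ} (hβ : 0 ≤ β) (θ : ℝ) : cumulantDeriv β θ ≤ Real.sigmoid θ := by
  have h := intervalIntegral.integral_mono_on (zero_le_one' ℝ) (intervalIntegrable_sigmoid β θ 0 1)
    (intervalIntegrable_const (c := Real.sigmoid θ)) fun u hu =>
      Real.sigmoid_le (by nlinarith [mul_nonneg hβ hu.1])
  simpa [cumulantDeriv] using h

lemma le_cumulantDeriv {β : ℝ} (hβ : 0 ≤ β) (θ : ℝ) :
    Real.sigmoid (θ - β) ≤ cumulantDeriv β θ := by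
  have h := intervalIntegral.integral_mono_on (zero_le_one' ℝ)
    (intervalIntegrable_const (c := Real.sigmoid (θ - β))) (intervalIntegrable_sigmoid β θ 0 1)
    fun u hu => Real.sigmoid_le (by nlinarith [mul_nonneg hβ (sub_nonneg.2 hu.2)])
  simpa [cumulantDeriv] using h

lemma cumulantDeriv_pos {β : ℝ} (hβ : 0 ≤ β) (θ : ℝ) : 0 < cumulantDeriv β θ :=
  (Real.sigmoid_pos _).trans_le (le_cumulantDeriv hβ θ)

lemma cumulantDeriv_lt_one {β : ℝ} (hβ : 0 ≤ β) (θ : ℝ) : cumulantDeriv β θ < 1 :=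
  (cumulantDeriv_le hβ θ).trans_lt (Real.sigmoid_lt_one _)

/-- After the substitution `v = θ - β * u`, the cumulant is a difference of values of one
antiderivative of softplus, so the fundamental theorem of calculus applies. -/
lemma hasDerivAt_cumulant {β : ℝ} (hβ : 0 < β) (θ : ℝ) :
    HasDerivAt (cumulant β) (cumulantDeriv β θ) θ := by
  have hM : ∀ x : ℝ, HasDerivAt (fun x => ∫ v in (0 : ℝ)..x, softplus v) (softplus x) x :=
    fun x => (continuous_softplus.integral_hasStrictDerivAt 0 x).hasDerivAt
  have e : cumulant β = fun θ => β⁻¹ *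
      ((∫ v in (0 : ℝ)..θ, softplus v) - ∫ v in (0 : ℝ)..(θ - β), softplus v) := by
    ext θ
    rw [cumulant, intervalIntegral.integral_comp_sub_mul _ hβ.ne',
      intervalIntegral.integral_interval_sub_left (continuous_softplus.intervalIntegrable _ _)
        (continuous_softplus.intervalIntegrable _ _)]
    simp
  rw [e]
  have h1 : HasDerivAt (fun θ : ℝ => θ - β) 1 θ := (hasDerivAt_id θ).sub_const β
  refine (((hM θ).sub ((hM (θ - β)).comp θ h1)).const_mul β⁻¹).congr_deriv ?_
  rw [mul_one, ← mul_cumulantDeriv, inv_mul_cancel_left₀ hβ.ne']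

lemma hasDerivAt_cumulantDeriv {β : ℝ} (hβ : 0 < β) (θ : ℝ) :
    HasDerivAt (cumulantDeriv β) (β⁻¹ * (Real.sigmoid θ - Real.sigmoid (θ - β))) θ := by
  have e : cumulantDeriv β = fun θ => β⁻¹ * (softplus θ - softplus (θ - β)) := by
    ext θ
    rw [← mul_cumulantDeriv, inv_mul_cancel_left₀ hβ.ne']
  rw [e]
  have h1 : HasDerivAt (fun θ : ℝ => θ - β) 1 θ := (hasDerivAt_id θ).sub_const β
  refine (((hasDerivAt_softplus θ).sub ((hasDerivAt_softplus (θ - β)).comp θ h1)).const_mul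
    β⁻¹).congr_deriv ?_
  rw [mul_one]

lemma continuous_cumulantDeriv {β : ℝ} (hβ : 0 < β) : Continuous (cumulantDeriv β) :=
  continuous_iff_continuousAt.2 fun θ => (hasDerivAt_cumulantDeriv hβ θ).continuousAt

lemma exists_cumulantDeriv_eq {β : ℝ} (hβ : 0 < β) {t : ℝ} (h0 : 0 < t) (h1 : t < 1) :
    ∃ θ, cumulantDeriv β θ = t := by
  obtain ⟨v, rfl⟩ : t ∈ range Real.sigmoid := by rw [Real.range_sigmoid]; exact ⟨h0, h1⟩
  have h2 := le_cumulantDeriv hβ.le (v + β)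
  rw [add_sub_cancel_right] at h2
  obtain ⟨θ, -, h⟩ := intermediate_value_Icc (by linarith : v ≤ v + β)
    (continuous_cumulantDeriv hβ).continuousOn ⟨cumulantDeriv_le hβ.le v, h2⟩
  exact ⟨θ, h⟩

/-! ### Riemann sums for the partition function -/

/-- The logarithm of `∏ i, (1 + exp (θ - β * i / n))`, where `i = 1, …, n`. -/
def logPartition (β : ℝ) (n : ℕ) (θ : ℝ) : ℝ :=
  ∑ j : Fin n, softplus (θ - β * ((j : ℕ) + 1) / n)

lemma logPartition_le {β : ℝ} (hβ : 0 ≤ β) (n : ℕ) (θ : ℝ) :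
    logPartition β n θ ≤ n * cumulant β θ ∧ n * cumulant β θ ≤ logPartition β n θ + β := by
  rcases eq_or_ne n 0 with rfl | hn
  · simpa [logPartition] using hβ
  have hn' : (0 : ℝ) < n := by positivity
  set f : ℝ → ℝ := fun x => softplus (θ - β * x / n) with hf
  have hanti : Antitone f := fun x y hxy => softplus_mono (by gcongr)
  have hint : n * cumulant β θ = ∫ x in (0 : ℝ)..(0 + n), f x := by
    have h := intervalIntegral.integral_comp_mul_left (a := 0) (b := 1) f hn'.ne'
    rw [mul_zero, mul_one, smul_eq_mul] at h
    have e : cumulant β θ = ∫ x in (0 : ℝ)..1, f (n * x) := by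
      rw [cumulant]
      congr 1
      ext u
      simp only [hf]
      congr 2
      field_simp
    rw [e, h, zero_add, mul_inv_cancel_left₀ hn'.ne']
  have hsum : logPartition β n θ = ∑ i ∈ Finset.range n, f (0 + (i + 1 : ℕ)) := by
    rw [logPartition, ← Fin.sum_univ_eq_sum_range (fun i => f (0 + (i + 1 : ℕ)))]
    simp [hf]
  have h1 := (hanti.antitoneOn (Icc 0 (0 + (n : ℝ)))).sum_le_integral
  have h2 := (hanti.antitoneOn (Icc 0 (0 + (n : ℝ)))).integral_le_sum
  rw [← hsum, ← hint] at h1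
  rw [← hint] at h2
  refine ⟨h1, h2.trans ?_⟩
  -- Left and right Riemann sums differ by `f 0 - f n`, at most `β` because softplus is 1-Lipschitz.
  have h3 : ∑ i ∈ Finset.range n, f (0 + (i : ℕ)) + f n = logPartition β n θ + f 0 := by
    rw [hsum]
    have e1 := Finset.sum_range_succ (fun i : ℕ => f i) n
    have e2 := Finset.sum_range_succ' (fun i : ℕ => f i) n
    simp only [zero_add]
    rw [← e1, e2, Nat.cast_zero]
  have h4 : f 0 ≤ f n + β := by
    have h5 := softplus_tangent_le θ (θ - β)
    have h6 := Real.sigmoid_le_one θ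
    have e0 : f 0 = softplus θ := by simp [hf]
    have e1 : f n = softplus (θ - β) := by
      simp only [hf]
      rw [mul_div_assoc, div_self hn'.ne', mul_one]
    rw [e0, e1]
    nlinarith
  linarith

lemma tendsto_logPartition {β : ℝ} (hβ : 0 ≤ β) (θ : ℝ) :
    Tendsto (fun n : ℕ => 1 / (n : ℝ) * logPartition β n θ) atTop (𝓝 (cumulant β θ)) := by
  refine tendsto_of_abs_sub_le (b := fun n => n * cumulant β θ) (e := fun _ => β) ?_ ?_ ?_
  · refine tendsto_const_nhds.congr' ?_
    filter_upwards [eventually_ne_atTop 0] with n hn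
    field_simp
  · simpa using tendsto_one_div_atTop_nhds_zero_nat.mul_const β
  · refine Eventually.of_forall fun n => ?_
    obtain ⟨h1, h2⟩ := logPartition_le hβ n θ
    exact abs_le.2 ⟨by linarith, by linarith⟩

/-! ### The soft-decision law and its generating function -/

lemma sum_exp_sum_ite {ι : Type*} [Fintype ι] [DecidableEq ι] (a : ι → ℝ) :
    ∑ z : ι → Bool, Real.exp (∑ i, if z i then a i else 0) =
      Real.exp (∑ i, softplus (a i)) := by
  rw [Real.exp_sum]
  simp only [exp_softplus]
  have h := Finset.prod_univ_sum (fun _ : ι => (Finset.univ : Finset Bool))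
    fun i b => Real.exp (if b then a i else 0)
  rw [Fintype.piFinset_univ] at h
  simp only [Fintype.sum_bool, if_true, Bool.false_eq_true, if_false, Real.exp_zero] at h
  simp only [Real.exp_sum]
  rw [← h]
  exact Finset.prod_congr rfl fun i _ => add_comm _ _

/-- The log-likelihood ratio of a flip at the position of reliability rank `j + 1`. -/
def flipLogit (β : ℝ) {n : ℕ} (j : Fin n) : ℝ := 0 - β * ((j : ℕ) + 1) / n

lemma flipProb_eq (β : ℝ) {n : ℕ} (j : Fin n) :
    flipProb β n ((j : ℕ) + 1) = Real.exp (flipLogit β j - softplus (flipLogit β j)) := by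
  have h : -β * (((j : ℕ) + 1 : ℕ) : ℝ) / n = flipLogit β j := by
    rw [flipLogit]; push_cast; ring
  rw [flipProb, h, Real.exp_sub, exp_softplus]

lemma one_sub_flipProb_eq (β : ℝ) {n : ℕ} (j : Fin n) :
    1 - flipProb β n ((j : ℕ) + 1) = Real.exp (-softplus (flipLogit β j)) := by
  rw [flipProb_eq, Real.exp_sub, Real.exp_neg, exp_softplus]
  have := one_add_exp_pos (flipLogit β j)
  field_simp
  ring

lemma sum_softplus_flipLogit (β : ℝ) (n : ℕ) :
    ∑ j : Fin n, softplus (flipLogit β j) = logPartition β n 0 := rfl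

lemma softNoise_eq (β : ℝ) {n : ℕ} (τ : Equiv.Perm (Fin n)) (z : Fin n → Bool) :
    softNoise β τ z =
      Real.exp ((∑ i, if z i then flipLogit β (τ i) else 0) - logPartition β n 0) := by
  rw [← sum_softplus_flipLogit, ← Equiv.sum_comp τ fun j => softplus (flipLogit β j),
    ← Finset.sum_sub_distrib, Real.exp_sum, softNoise, channelProb]
  refine Finset.prod_congr rfl fun i _ => ?_
  rcases Bool.eq_false_or_eq_true (z i) with h | h
  · simp [h, flipProb_eq]
  · simp [h, one_sub_flipProb_eq]

lemma softNoise_pos (β : ℝ) {n : ℕ} (τ : Equiv.Perm (Fin n)) (z : Fin n → Bool) :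
    0 < softNoise β τ z := by
  rw [softNoise_eq]
  exact Real.exp_pos _

lemma flipLogit_nonpos {β : ℝ} (hβ : 0 ≤ β) {n : ℕ} (j : Fin n) : flipLogit β j ≤ 0 := by
  rw [flipLogit, zero_sub, neg_nonpos]
  positivity

lemma neg_le_flipLogit {β : ℝ} (hβ : 0 ≤ β) {n : ℕ} (j : Fin n) : -β ≤ flipLogit β j := by
  have hn : (0 : ℝ) < n := by exact_mod_cast j.pos
  have hj : ((j : ℕ) : ℝ) + 1 ≤ n := by exact_mod_cast j.isLt
  rw [flipLogit, zero_sub, neg_le_neg_iff, div_le_iff₀ hn]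
  exact mul_le_mul_of_nonneg_left hj hβ

lemma softNoise_zero (β : ℝ) {n : ℕ} (τ : Equiv.Perm (Fin n)) :
    softNoise β τ (fun _ => false) = Real.exp (-logPartition β n 0) := by
  rw [softNoise_eq]
  simp

lemma softNoise_le_softNoise_zero {β : ℝ} (hβ : 0 ≤ β) {n : ℕ} (τ : Equiv.Perm (Fin n))
    (z : Fin n → Bool) : softNoise β τ z ≤ softNoise β τ fun _ => false := by
  rw [softNoise_zero, softNoise_eq]
  refine Real.exp_le_exp.2 ?_
  have : (∑ i, if z i then flipLogit β (τ i) else 0) ≤ 0 :=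
    Finset.sum_nonpos fun i _ => by
      split_ifs
      · exact flipLogit_nonpos hβ _
      · exact le_rfl
  linarith

lemma logPartition_zero_le {β : ℝ} (hβ : 0 ≤ β) (n : ℕ) :
    logPartition β n 0 ≤ n * Real.log 2 := by
  rw [← sum_softplus_flipLogit]
  refine (Finset.sum_le_card_nsmul _ _ (Real.log 2) fun j _ => ?_).trans (by simp)
  rw [← softplus_zero]
  exact softplus_mono (flipLogit_nonpos hβ j)

lemma exp_neg_le_softNoise {β : ℝ} (hβ : 0 ≤ β) {n : ℕ} (τ : Equiv.Perm (Fin n))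
    (z : Fin n → Bool) : Real.exp (-(n * (β + Real.log 2))) ≤ softNoise β τ z := by
  rw [softNoise_eq]
  refine Real.exp_le_exp.2 ?_
  have h1 : (n : ℝ) * (-β) ≤ ∑ i, if z i then flipLogit β (τ i) else 0 := by
    have h := Finset.card_nsmul_le_sum (Finset.univ : Finset (Fin n))
      (fun i => if z i then flipLogit β (τ i) else 0) (-β) fun i _ => by
        split_ifs
        · exact neg_le_flipLogit hβ _
        · linarith
    simpa using h
  have h2 := logPartition_zero_le hβ n
  linarith

/-- The log-likelihood ratios are linear in `β`, so the power `s` of the law is, up to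
normalization, the law with parameter `β * s`. -/
lemma sum_softNoise_rpow (β : ℝ) {n : ℕ} (τ : Equiv.Perm (Fin n)) (s : ℝ) :
    ∑ z, softNoise β τ z ^ s =
      Real.exp (logPartition (β * s) n 0 - s * logPartition β n 0) := by
  have h : ∀ z, softNoise β τ z ^ s =
      Real.exp (∑ i, if z i then flipLogit (β * s) (τ i) else 0) *
        Real.exp (-(s * logPartition β n 0)) := by
    intro z
    rw [softNoise_eq, ← Real.exp_mul, ← Real.exp_add, sub_mul, Finset.sum_mul]
    congr 1
    rw [sub_eq_add_neg, mul_comm _ s]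
    congr 1
    refine Finset.sum_congr rfl fun i _ => ?_
    split_ifs
    · rw [flipLogit, flipLogit]; ring
    · simp
  simp only [h]
  rw [← Finset.sum_mul, sum_exp_sum_ite, Equiv.sum_comp τ fun j => softplus (flipLogit (β * s) j),
    sum_softplus_flipLogit, ← Real.exp_add]
  rfl

/-- The scaled cumulant generating function of the soft-decision guesswork process. -/
def softSCGF (β α : ℝ) : ℝ :=
  if -1 < α then (1 + α) * cumulant (β * (1 / (1 + α))) 0 - cumulant β 0 else -cumulant β 0

lemma tendsto_log_softNoise_zero {β : ℝ} (hβ : 0 ≤ β) (τ : (n : ℕ) → Equiv.Perm (Fin n)) :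
    Tendsto (fun n : ℕ => 1 / (n : ℝ) * Real.log (softNoise β (τ n) fun _ => false)) atTop
      (𝓝 (-cumulant β 0)) := by
  simp only [softNoise_zero, Real.log_exp, mul_neg]
  exact (tendsto_logPartition hβ 0).neg

lemma isSCGF_soft {β : ℝ} (hβ : 0 ≤ β) (τ : (n : ℕ) → Equiv.Perm (Fin n))
    {G : (n : ℕ) → (Fin n → Bool) → ℕ} (hG : ∀ n, IsOptimalGuessing (softNoise β (τ n)) (G n)) :
    IsSCGF (fun n => softNoise β (τ n)) (guesswork G) (softSCGF β) := by
  refine isSCGF_guesswork hG (fun n => softNoise_pos β (τ n)) (fun α hα => ?_)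
    (fun n => softNoise_le_softNoise_zero hβ (τ n)) fun α hα => ?_
  · have hα' : 0 < 1 + α := by linarith
    rw [softSCGF, if_pos hα]
    simp only [sum_softNoise_rpow, Real.log_exp]
    refine (((tendsto_logPartition (β := β * (1 / (1 + α))) (by positivity) 0).const_mul
      (1 + α)).sub (tendsto_logPartition hβ 0)).congr fun n => ?_
    field_simp
  · rw [softSCGF, if_neg (not_lt.2 hα)]
    exact tendsto_log_softNoise_zero hβ τ

/-- The limiting entropy rate of independent bits with log-likelihood ratios `-b * i / n`. -/
def meanEntropy (b : ℝ) : ℝ := ∫ u in (0 : ℝ)..1, Real.binEntropy (Real.sigmoid (0 - b * u))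

lemma continuous_binEntropy_sigmoid (b : ℝ) :
    Continuous fun u : ℝ => Real.binEntropy (Real.sigmoid (0 - b * u)) :=
  Real.binEntropy_continuous.comp (continuous_sigmoid.comp (by fun_prop))

lemma meanEntropy_pos (b : ℝ) : 0 < meanEntropy b :=
  intervalIntegral.intervalIntegral_pos_of_pos
    ((continuous_binEntropy_sigmoid b).intervalIntegrable 0 1)
    (fun _ => Real.binEntropy_pos (Real.sigmoid_pos _) (Real.sigmoid_lt_one _)) one_pos

/-- Pointwise in `u`, this is `1 + α` times the tangent inequality for softplus at `-βu/2`,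
evaluated at `-βu/(1 + α)`. The entropy arises as the coefficient of `α - 1`. -/
lemma softSCGF_strict_support {β : ℝ} (hβ : 0 < β) {α : ℝ} (hα : 0 < α) (h1 : α ≠ 1) :
    softSCGF β 1 + meanEntropy (β / 2) * (α - 1) < softSCGF β α := by
  have hα' : 0 < 1 + α := by linarith
  rw [softSCGF, softSCGF, if_pos (by norm_num), if_pos (by linarith)]
  have hc1 : Continuous fun u : ℝ => softplus (0 - β * (1 / (1 + 1)) * u) :=
    continuous_softplus.comp (by fun_prop)
  have hc2 : Continuous fun u : ℝ => softplus (0 - β * (1 / (1 + α)) * u) :=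
    continuous_softplus.comp (by fun_prop)
  have hc3 := continuous_binEntropy_sigmoid (β / 2)
  suffices h : (1 + 1) * cumulant (β * (1 / (1 + 1))) 0 + meanEntropy (β / 2) * (α - 1) <
      (1 + α) * cumulant (β * (1 / (1 + α))) 0 by linarith
  rw [cumulant, cumulant, meanEntropy, ← intervalIntegral.integral_const_mul,
    ← intervalIntegral.integral_const_mul, ← intervalIntegral.integral_mul_const,
    ← intervalIntegral.integral_add ((hc1.const_mul _).intervalIntegrable 0 1)
      ((hc3.mul_const _).intervalIntegrable 0 1)]
  have key : ∀ u : ℝ, 0 < u → (1 + 1) * softplus (0 - β * (1 / (1 + 1)) * u) +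
      Real.binEntropy (Real.sigmoid (0 - β / 2 * u)) * (α - 1) <
      (1 + α) * softplus (0 - β * (1 / (1 + α)) * u) := by
    intro u hu
    have e : 0 - β * (1 / (1 + 1)) * u = 0 - β / 2 * u := by ring
    have hne : 0 - β * (1 / (1 + α)) * u ≠ 0 - β / 2 * u := by
      intro h
      have h2 : β * u * (1 / (1 + α) - 1 / 2) = 0 := by linarith
      have h3 : 1 / (1 + α) - 1 / 2 = 0 :=
        (mul_eq_zero.1 h2).resolve_left (mul_pos hβ hu).ne'
      field_simp at h3
      exact h1 (by linarith)
    have h2 := mul_lt_mul_of_pos_left (softplus_tangent_lt hne) hα'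
    rw [e, binEntropy_sigmoid]
    refine lt_of_eq_of_lt ?_ h2
    field_simp
    ring
  refine intervalIntegral.integral_lt_integral_of_continuousOn_of_le_of_exists_lt one_pos
    ((hc1.const_mul _).add (hc3.mul_const _)).continuousOn (hc2.const_mul _).continuousOn
    (fun u hu => (key u hu.1).le) ⟨1, by simp, key 1 one_pos⟩

/-- The value of the derivative is not needed: the supporting line already determines it. -/
lemma differentiableAt_softSCGF {β : ℝ} (hβ : 0 < β) : DifferentiableAt ℝ (softSCGF β) 1 := by
  have hM : ∀ x : ℝ, HasDerivAt (fun x => ∫ v in x..(0 : ℝ), softplus v) (-softplus x) x :=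
    fun x => intervalIntegral.integral_hasDerivAt_left (continuous_softplus.intervalIntegrable _ _)
      (continuous_softplus.stronglyMeasurableAtFilter _ _) continuous_softplus.continuousAt
  have e : softSCGF β =ᶠ[𝓝 1] fun α => (1 + α) * ((β * (1 / (1 + α)))⁻¹ *
      ∫ v in (0 - β * (1 / (1 + α)))..0, softplus v) - cumulant β 0 := by
    filter_upwards [lt_mem_nhds (show (0 : ℝ) < 1 by norm_num)] with α hα
    have hα' : 0 < 1 + α := by linarith
    rw [softSCGF, if_pos (by linarith), cumulant,
      intervalIntegral.integral_comp_sub_mul _ (by positivity : β * (1 / (1 + α)) ≠ 0)]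
    simp
  refine DifferentiableAt.congr_of_eventuallyEq ?_ e
  have h1 : DifferentiableAt ℝ (fun α : ℝ => β * (1 / (1 + α))) 1 := by
    fun_prop (disch := norm_num)
  have h2 : DifferentiableAt ℝ
      (fun α : ℝ => ∫ v in (0 - β * (1 / (1 + α)))..0, softplus v) 1 :=
    DifferentiableAt.comp (1 : ℝ) (f := fun α : ℝ => 0 - β * (1 / (1 + α)))
      (hM _).differentiableAt (h1.const_sub 0)
  have h3 : DifferentiableAt ℝ (fun α : ℝ => (β * (1 / (1 + α)))⁻¹) 1 :=
    h1.inv (by norm_num; exact hβ.ne')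
  exact ((((differentiableAt_id).const_add 1)).mul (h3.mul h2)).sub_const _

/-! ### The hard-decision law and Hamming weight classes -/

/-- The Hamming weight of a binary sequence. -/
def weight {n : ℕ} (z : Fin n → Bool) : ℕ := (Finset.univ.filter fun i => z i = true).card

lemma weight_le {n : ℕ} (z : Fin n → Bool) : weight z ≤ n := by
  simpa [weight] using Finset.card_le_univ (Finset.univ.filter fun i => z i = true)

lemma weight_comp_perm {n : ℕ} (z : Fin n → Bool) (σ : Equiv.Perm (Fin n)) :
    weight (fun i => z (σ i)) = weight z := by
  unfold weight
  refine Finset.card_bij (fun i _ => σ i) (by simp) (fun i _ j _ h => σ.injective h)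
    fun j hj => ⟨σ.symm j, by simpa using hj, by simp⟩

lemma exists_perm_of_weight_eq {n : ℕ} {z z' : Fin n → Bool} (h : weight z = weight z') :
    ∃ σ : Equiv.Perm (Fin n), ∀ i, z' (σ i) = z i := by
  have hc : ∀ c : Bool, Fintype.card {i // z i = c} = Fintype.card {i // z' i = c} := by
    have ht : Fintype.card {i // z i = true} = Fintype.card {i // z' i = true} := by
      rw [Fintype.card_subtype, Fintype.card_subtype]
      exact h
    intro c
    cases c
    · have h1 := Fintype.card_compl_eq_card_compl (fun i => z i = true) (fun i => z' i = true) ht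
      simpa using h1
    · exact ht
  exact ⟨Equiv.ofFiberEquiv fun c => Fintype.equivOfCardEq (hc c),
    fun i => Equiv.ofFiberEquiv_map _ i⟩

/-- The binary sequences of weight `w`. -/
def weightClass (n w : ℕ) : Finset (Fin n → Bool) := Finset.univ.filter fun z => weight z = w

lemma mem_weightClass {n w : ℕ} {z : Fin n → Bool} : z ∈ weightClass n w ↔ weight z = w := by
  simp [weightClass]

lemma card_weightClass (n w : ℕ) : (weightClass n w).card = n.choose w := by
  have h := Finset.card_powersetCard w (Finset.univ : Finset (Fin n))
  rw [Finset.card_univ, Fintype.card_fin] at h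
  rw [← h]
  refine Finset.card_nbij' (fun z => Finset.univ.filter fun i => z i = true)
    (fun s i => decide (i ∈ s)) ?_ ?_ ?_ ?_
  · intro z hz
    simp only [Finset.mem_coe, mem_weightClass] at hz
    simpa [Finset.mem_powersetCard, weight] using hz
  · intro s hs
    simp only [Finset.mem_coe, Finset.mem_powersetCard, Finset.subset_univ, true_and] at hs
    simpa [mem_weightClass, weight] using hs
  · intro z _
    ext i
    simp
  · intro s _
    ext i
    simp

lemma sum_eq_sum_weightClass {n : ℕ} (f : (Fin n → Bool) → ℝ) :
    ∑ z, f z = ∑ w ∈ Finset.range (n + 1), ∑ z ∈ weightClass n w, f z :=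
  (Finset.sum_fiberwise_of_maps_to
    (fun z _ => Finset.mem_range.2 (Nat.lt_succ_of_le (weight_le z))) f).symm

/-- The elementary symmetric polynomial of degree `w` in the odds `exp (-β * i / n)` of the
bit flips, where `i = 1, …, n`. -/
def oddsSum (β : ℝ) (n w : ℕ) : ℝ :=
  ∑ z ∈ weightClass n w, Real.exp (∑ i, if z i then flipLogit β i else 0)

lemma oddsSum_pos (β : ℝ) {n w : ℕ} (h : w ≤ n) : 0 < oddsSum β n w :=
  Finset.sum_pos (fun _ _ => Real.exp_pos _)
    (Finset.card_pos.1 (by rw [card_weightClass]; exact Nat.choose_pos h))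

lemma oddsSum_le_choose {β : ℝ} (hβ : 0 ≤ β) (n w : ℕ) : oddsSum β n w ≤ n.choose w := by
  rw [← card_weightClass]
  refine (Finset.sum_le_card_nsmul _ _ 1 fun z _ => ?_).trans (by simp)
  refine Real.exp_le_one_iff.2 (Finset.sum_nonpos fun i _ => ?_)
  split_ifs
  · exact flipLogit_nonpos hβ i
  · exact le_rfl

lemma one_le_oddsSum_zero (β : ℝ) (n : ℕ) : 1 ≤ oddsSum β n 0 := by
  have h : (fun _ => false) ∈ weightClass n 0 := by simp [mem_weightClass, weight]
  refine le_trans ?_ (Finset.single_le_sum (fun z _ => (Real.exp_pos _).le) h)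
  simp

lemma sum_oddsSum_mul_exp (β : ℝ) (n : ℕ) (θ : ℝ) :
    ∑ w ∈ Finset.range (n + 1), oddsSum β n w * Real.exp (θ * w) =
      Real.exp (logPartition β n θ) := by
  have h := sum_exp_sum_ite fun i : Fin n => flipLogit β i + θ
  rw [sum_eq_sum_weightClass] at h
  have e : ∑ i : Fin n, softplus (flipLogit β i + θ) = logPartition β n θ :=
    Finset.sum_congr rfl fun i _ => by rw [flipLogit]; congr 1; ring
  rw [← e, ← h]
  refine Finset.sum_congr rfl fun w _ => ?_
  rw [oddsSum, Finset.sum_mul]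
  refine Finset.sum_congr rfl fun z hz => ?_
  rw [← Real.exp_add]
  congr 1
  rw [← mem_weightClass.1 hz, weight, mul_comm θ, ← nsmul_eq_mul, ← Finset.sum_const,
    Finset.sum_filter, ← Finset.sum_add_distrib]
  refine Finset.sum_congr rfl fun i _ => ?_
  split_ifs <;> simp

/-- Chernoff bound: one term of the tilted sum is at most the whole. -/
lemma log_oddsSum_le (β : ℝ) {n w : ℕ} (h : w ≤ n) (θ : ℝ) :
    Real.log (oddsSum β n w) ≤ logPartition β n θ - θ * w := by
  have h1 := Finset.single_le_sum (f := fun w : ℕ => oddsSum β n w * Real.exp (θ * w))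
    (fun v hv => mul_nonneg (oddsSum_pos β (Nat.lt_succ_iff.1 (Finset.mem_range.1 hv))).le
      (Real.exp_pos _).le) (Finset.mem_range.2 (Nat.lt_succ_of_le h))
  rw [sum_oddsSum_mul_exp] at h1
  have h0 := oddsSum_pos β h
  have h2 := Real.log_le_log (mul_pos h0 (Real.exp_pos _)) h1
  rw [Real.log_mul h0.ne' (Real.exp_pos _).ne', Real.log_exp, Real.log_exp] at h2
  linarith

/-- A weight of maximal probability under the law of parameter `θ` carries at least the
fraction `1 / (n + 1)` of the mass. -/
lemma exists_logPartition_le (β : ℝ) (n : ℕ) (θ : ℝ) :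
    ∃ w ≤ n, logPartition β n θ ≤ Real.log (oddsSum β n w) + θ * w + Real.log (1 + n) := by
  obtain ⟨w, hw, hmax⟩ := Finset.exists_max_image (Finset.range (n + 1))
    (fun w : ℕ => oddsSum β n w * Real.exp (θ * w)) ⟨0, by simp⟩
  have hw' : w ≤ n := Nat.lt_succ_iff.1 (Finset.mem_range.1 hw)
  refine ⟨w, hw', ?_⟩
  have h := Finset.sum_le_card_nsmul _ _ _ hmax
  rw [sum_oddsSum_mul_exp, Finset.card_range, nsmul_eq_mul] at h
  have h0 := oddsSum_pos β hw'
  have h2 := Real.log_le_log (Real.exp_pos _) h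
  rw [Real.log_exp, Real.log_mul (by positivity) (mul_pos h0 (Real.exp_pos _)).ne',
    Real.log_mul h0.ne' (Real.exp_pos _).ne', Real.log_exp] at h2
  push_cast at h2
  rw [add_comm (n : ℝ) 1] at h2
  linarith

lemma sum_perm_comp_eq (β : ℝ) {n : ℕ} {z z' : Fin n → Bool} (h : weight z = weight z') :
    ∑ τ : Equiv.Perm (Fin n), Real.exp (∑ i, if z i then flipLogit β (τ i) else 0) =
      ∑ τ : Equiv.Perm (Fin n), Real.exp (∑ i, if z' i then flipLogit β (τ i) else 0) := by
  obtain ⟨σ, hσ⟩ := exists_perm_of_weight_eq h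
  rw [← Equiv.sum_comp (Equiv.mulRight σ)
    fun τ : Equiv.Perm (Fin n) => Real.exp (∑ i, if z i then flipLogit β (τ i) else 0)]
  refine Finset.sum_congr rfl fun τ _ => ?_
  rw [← Equiv.sum_comp σ fun i => if z' i then flipLogit β (τ i) else 0]
  simp [hσ]

lemma sum_weightClass_perm (β : ℝ) {n : ℕ} (w : ℕ) (τ : Equiv.Perm (Fin n)) :
    ∑ z ∈ weightClass n w, Real.exp (∑ i, if z i then flipLogit β (τ i) else 0) =
      oddsSum β n w := by
  refine Finset.sum_nbij' (fun z i => z (τ.symm i)) (fun z i => z (τ i)) ?_ ?_ ?_ ?_ ?_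
  · intro z hz
    rw [mem_weightClass] at hz ⊢
    rw [weight_comp_perm z τ.symm, hz]
  · intro z hz
    rw [mem_weightClass] at hz ⊢
    rw [weight_comp_perm z τ, hz]
  · intro z _
    simp
  · intro z _
    simp
  · intro z _
    rw [← Equiv.sum_comp τ fun i => if z (τ.symm i) then flipLogit β i else 0]
    simp

/-- Double counting over pairs of a permutation and a sequence of the given weight: the sum over the
class is independent of the permutation, and the sum over permutations depends only on the weight.
-/
lemma hardNoise_eq (β : ℝ) {n : ℕ} (z : Fin n → Bool) :
    hardNoise β z =
      oddsSum β n (weight z) / n.choose (weight z) * Real.exp (-logPartition β n 0) := by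
  have h1 : ∑ z' ∈ weightClass n (weight z), ∑ τ : Equiv.Perm (Fin n),
      Real.exp (∑ i, if z' i then flipLogit β (τ i) else 0) =
      n.factorial * oddsSum β n (weight z) := by
    rw [Finset.sum_comm]
    simp only [sum_weightClass_perm]
    simp [Fintype.card_perm]
  have h2 : ∑ z' ∈ weightClass n (weight z), ∑ τ : Equiv.Perm (Fin n),
      Real.exp (∑ i, if z' i then flipLogit β (τ i) else 0) =
      n.choose (weight z) * ∑ τ : Equiv.Perm (Fin n),
        Real.exp (∑ i, if z i then flipLogit β (τ i) else 0) := by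
    rw [← card_weightClass, ← nsmul_eq_mul]
    exact Finset.sum_eq_card_nsmul fun z' hz' => sum_perm_comp_eq β (mem_weightClass.1 hz')
  have h3 : (n.choose (weight z) : ℝ) ≠ 0 := by
    exact_mod_cast (Nat.choose_pos (weight_le z)).ne'
  have h4 : (n.factorial : ℝ) ≠ 0 := by exact_mod_cast n.factorial_ne_zero
  rw [h1] at h2
  rw [hardNoise]
  simp only [softNoise_eq, sub_eq_add_neg, Real.exp_add]
  rw [← Finset.sum_mul]
  field_simp
  linear_combination -h2

lemma hardNoise_pos (β : ℝ) {n : ℕ} (z : Fin n → Bool) : 0 < hardNoise β z :=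
  div_pos (Finset.sum_pos (fun τ _ => softNoise_pos β τ z) Finset.univ_nonempty)
    (by exact_mod_cast n.factorial_pos)

lemma exp_neg_le_hardNoise {β : ℝ} (hβ : 0 ≤ β) {n : ℕ} (z : Fin n → Bool) :
    Real.exp (-(n * (β + Real.log 2))) ≤ hardNoise β z := by
  rw [hardNoise, le_div_iff₀ (by exact_mod_cast n.factorial_pos)]
  have h := Finset.card_nsmul_le_sum (Finset.univ : Finset (Equiv.Perm (Fin n))) _ _
    fun τ _ => exp_neg_le_softNoise hβ τ z
  rw [Finset.card_univ, Fintype.card_perm, Fintype.card_fin, nsmul_eq_mul] at h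
  linarith

lemma hardNoise_zero (β : ℝ) (n : ℕ) :
    hardNoise β (fun _ : Fin n => false) = Real.exp (-logPartition β n 0) := by
  have h4 : (n.factorial : ℝ) ≠ 0 := by exact_mod_cast n.factorial_ne_zero
  rw [hardNoise]
  simp only [softNoise_zero]
  rw [Finset.sum_const, Finset.card_univ, Fintype.card_perm, Fintype.card_fin, nsmul_eq_mul,
    mul_div_cancel_left₀ _ h4]

lemma hardNoise_le_hardNoise_zero {β : ℝ} (hβ : 0 ≤ β) {n : ℕ} (z : Fin n → Bool) :
    hardNoise β z ≤ hardNoise β fun _ : Fin n => false :=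
  div_le_div_of_nonneg_right
    (Finset.sum_le_sum fun τ _ => softNoise_le_softNoise_zero hβ τ z) (Nat.cast_nonneg _)

lemma sum_hardNoise_rpow (β : ℝ) (n : ℕ) {α : ℝ} (hα : -1 < α) :
    ∑ z : Fin n → Bool, hardNoise β z ^ (1 / (1 + α)) =
      (∑ w ∈ Finset.range (n + 1), Real.exp (1 / (1 + α) *
        (Real.log (oddsSum β n w) + α * Real.log (n.choose w)))) *
        Real.exp (-(1 / (1 + α) * logPartition β n 0)) := by
  have hα' : 1 + α ≠ 0 := by linarith
  rw [sum_eq_sum_weightClass, Finset.sum_mul]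
  refine Finset.sum_congr rfl fun w hw => ?_
  have hw' : w ≤ n := Nat.lt_succ_iff.1 (Finset.mem_range.1 hw)
  have h0 := oddsSum_pos β hw'
  have hc : (0 : ℝ) < n.choose w := by exact_mod_cast Nat.choose_pos hw'
  have e : ∀ z ∈ weightClass n w, hardNoise β z ^ (1 / (1 + α)) = Real.exp (1 / (1 + α) *
      (Real.log (oddsSum β n w) - Real.log (n.choose w) - logPartition β n 0)) := by
    intro z hz
    rw [hardNoise_eq, mem_weightClass.1 hz, Real.rpow_def_of_pos (by positivity),
      Real.log_mul (div_pos h0 hc).ne' (Real.exp_pos _).ne', Real.log_div h0.ne' hc.ne',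
      Real.log_exp]
    ring_nf
  rw [Finset.sum_congr rfl e, Finset.sum_const, card_weightClass, nsmul_eq_mul, ← Real.exp_add]
  conv_lhs => rw [← Real.exp_log hc, ← Real.exp_add, Real.log_exp]
  congr 1
  field_simp
  ring

/-! ### Binomial coefficients and entropy -/

lemma le_log_factorial (n : ℕ) : n * Real.log n - n ≤ Real.log n.factorial := by
  rcases eq_or_ne n 0 with rfl | hn
  · simp
  have hn' : (0 : ℝ) < n := by positivity
  have hf : (0 : ℝ) < n.factorial := by exact_mod_cast n.factorial_pos
  have h := Real.log_le_log (by positivity) (Real.pow_div_factorial_le_exp (n : ℝ) hn'.le n)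
  rw [Real.log_exp, Real.log_div (by positivity) hf.ne', Real.log_pow] at h
  linarith

lemma log_factorial_le (n : ℕ) :
    Real.log n.factorial ≤ n * Real.log n - n + (1 + Real.log (1 + n)) := by
  rcases eq_or_ne n 0 with rfl | hn
  · simp
  have h : Real.log n.factorial ≤ (n + 1) * Real.log n - n + 1 := by
    induction n, Nat.one_le_iff_ne_zero.2 hn using Nat.le_induction with
    | base => simp
    | succ k hk ih =>
      have hk' : (0 : ℝ) < k := by exact_mod_cast hk
      have h1 := ih (by omega)
      have h2 := Real.log_le_sub_one_of_pos (show 0 < (k : ℝ) / (k + 1) by positivity)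
      rw [Real.log_div hk'.ne' (by positivity)] at h2
      have h3 : (k : ℝ) / (k + 1) - 1 = -(1 / (k + 1)) := by field_simp; ring
      rw [h3] at h2
      have h4 := mul_le_mul_of_nonneg_left h2 (by positivity : (0 : ℝ) ≤ k + 1)
      have h5 : ((k : ℝ) + 1) * -(1 / (k + 1)) = -1 := by field_simp
      rw [h5] at h4
      have hf : (k.factorial : ℝ) ≠ 0 := by exact_mod_cast k.factorial_ne_zero
      rw [Nat.factorial_succ]
      push_cast
      rw [Real.log_mul (by positivity) hf]
      nlinarith
  have h1 : Real.log n ≤ Real.log (1 + n) :=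
    Real.log_le_log (by positivity) (by linarith)
  linarith

/-- The cases `w = 0` and `w = n` are covered by the convention `log 0 = 0`. -/
lemma mul_binEntropy_div {n w : ℕ} (h : w ≤ n) : n * Real.binEntropy ((w : ℝ) / n) =
    n * Real.log n - w * Real.log w - (n - w : ℕ) * Real.log (n - w : ℕ) := by
  rcases eq_or_ne n 0 with rfl | hn
  · simp [Nat.le_zero.1 h]
  have hn' : (0 : ℝ) < n := by positivity
  have key : ∀ k : ℕ, n * Real.negMulLog ((k : ℝ) / n) = k * Real.log n - k * Real.log k := by
    intro k
    rcases eq_or_ne k 0 with rfl | hk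
    · simp
    have hk' : (0 : ℝ) < k := by positivity
    rw [Real.negMulLog, Real.log_div hk'.ne' hn'.ne']
    field_simp
    ring
  have e : 1 - (w : ℝ) / n = ((n - w : ℕ) : ℝ) / n := by
    rw [Nat.cast_sub h]; field_simp
  rw [Real.binEntropy_eq_negMulLog_add_negMulLog_one_sub, mul_add, e, key, key, Nat.cast_sub h]
  ring

lemma abs_log_choose_sub_le {n w : ℕ} (h : w ≤ n) :
    |Real.log (n.choose w) - n * Real.binEntropy ((w : ℝ) / n)| ≤
      2 * (1 + Real.log (1 + n)) := by
  have hc : Real.log (n.choose w) =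
      Real.log n.factorial - Real.log w.factorial - Real.log (n - w).factorial := by
    have h0 := Nat.choose_mul_factorial_mul_factorial h
    have h1 : ((n.choose w : ℝ)) * w.factorial * (n - w).factorial = n.factorial := by
      exact_mod_cast h0
    have h2 : (n.choose w : ℝ) ≠ 0 := by exact_mod_cast (Nat.choose_pos h).ne'
    have h3 : (w.factorial : ℝ) ≠ 0 := by exact_mod_cast w.factorial_ne_zero
    have h4 : ((n - w).factorial : ℝ) ≠ 0 := by exact_mod_cast (n - w).factorial_ne_zero
    rw [← h1, Real.log_mul (mul_ne_zero h2 h3) h4, Real.log_mul h2 h3]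
    ring
  have hsub : ((n - w : ℕ) : ℝ) = n - w := Nat.cast_sub h
  have hm : ∀ k : ℕ, k ≤ n → Real.log (1 + k) ≤ Real.log (1 + n) := fun k hk =>
    Real.log_le_log (by positivity) (by exact_mod_cast Nat.add_le_add_left hk 1)
  have hp : 0 ≤ Real.log (1 + (n : ℝ)) :=
    Real.log_nonneg (by linarith [(Nat.cast_nonneg n : (0 : ℝ) ≤ n)])
  have a1 := le_log_factorial n
  have a2 := log_factorial_le n
  have b1 := le_log_factorial w
  have b2 := log_factorial_le w
  have c1 := le_log_factorial (n - w)
  have c2 := log_factorial_le (n - w)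
  have m1 := hm w h
  have m2 := hm (n - w) (Nat.sub_le n w)
  rw [hc, mul_binEntropy_div h, abs_le]
  constructor <;> linarith

lemma tendsto_binEntropy_error (c : ℝ) :
    Tendsto (fun n : ℕ => 1 / (n : ℝ) * (c * (2 * (1 + Real.log (1 + n))))) atTop (𝓝 0) := by
  have h1 := (tendsto_log_one_add_div (2 * c)).add
    (tendsto_one_div_atTop_nhds_zero_nat.mul_const (2 * c))
  rw [zero_mul, add_zero] at h1
  exact h1.congr fun n => by ring

/-! ### Large deviations of the weight and the hard-decision generating function -/

/-- The exponential growth rate of the contribution of the weights close to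
`n * cumulantDeriv β θ` to the guesswork moment of order `α`, before normalization. -/
def exponent (β α θ : ℝ) : ℝ :=
  cumulant β θ - θ * cumulantDeriv β θ + α * Real.binEntropy (cumulantDeriv β θ)

/-- The logarithm of the contribution of the weight `w` to the guesswork moment of order `α`,
before normalization. -/
def logWeightTerm (β α : ℝ) (n w : ℕ) : ℝ :=
  Real.log (oddsSum β n w) + α * Real.log (n.choose w)

/-- `(1 + α) * log (∑ w, exp (q w / (1 + α)))`, where `q = logWeightTerm β α n`. -/
def logWeightSum (β α : ℝ) (n : ℕ) : ℝ :=
  (1 + α) * Real.log (∑ w ∈ Finset.range (n + 1),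
    Real.exp (1 / (1 + α) * logWeightTerm β α n w))

lemma logWeightTerm_le_logWeightSum (β : ℝ) {α : ℝ} (hα : -1 < α) {n w : ℕ} (h : w ≤ n) :
    logWeightTerm β α n w ≤ logWeightSum β α n := by
  have hα' : 0 < 1 + α := by linarith
  have h1 := Finset.single_le_sum
    (f := fun w : ℕ => Real.exp (1 / (1 + α) * logWeightTerm β α n w))
    (fun _ _ => (Real.exp_pos _).le) (Finset.mem_range.2 (Nat.lt_succ_of_le h))
  have h2 := Real.log_le_log (Real.exp_pos _) h1
  rw [Real.log_exp, one_div, inv_mul_le_iff₀ hα'] at h2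
  simpa only [logWeightSum, one_div] using h2

lemma logWeightSum_le (β : ℝ) {α : ℝ} (hα : -1 < α) {n : ℕ} {B : ℝ}
    (h : ∀ w ≤ n, logWeightTerm β α n w ≤ B) :
    logWeightSum β α n ≤ B + (1 + α) * Real.log (1 + n) := by
  have hα' : 0 < 1 + α := by linarith
  have h1 := Finset.sum_le_card_nsmul (Finset.range (n + 1))
    (fun w : ℕ => Real.exp (1 / (1 + α) * logWeightTerm β α n w)) (Real.exp (1 / (1 + α) * B))
    fun w hw => Real.exp_le_exp.2 (mul_le_mul_of_nonneg_left
      (h w (Nat.lt_succ_iff.1 (Finset.mem_range.1 hw))) (by positivity))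
  rw [Finset.card_range, nsmul_eq_mul] at h1
  have h2 := Real.log_le_log (Finset.sum_pos (fun _ _ => Real.exp_pos _) ⟨0, by simp⟩) h1
  rw [Real.log_mul (by positivity) (Real.exp_pos _).ne', Real.log_exp] at h2
  have h3 := mul_le_mul_of_nonneg_left h2 hα'.le
  have e : (1 + α) * (Real.log ((n + 1 : ℕ) : ℝ) + 1 / (1 + α) * B) =
      B + (1 + α) * Real.log (1 + n) := by
    push_cast
    rw [add_comm (n : ℝ) 1]
    field_simp
    ring
  rw [e] at h3
  exact h3

/-- The unnormalized scaled cumulant generating function of the hard-decision guesswork. -/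
def supExponent (β α : ℝ) : ℝ := max 0 (⨆ θ, exponent β α θ)

lemma bddAbove_exponent {β : ℝ} (hβ : 0 < β) (α : ℝ) :
    BddAbove (range fun θ => exponent β α θ) := by
  refine ⟨cumulant β 0 + |α| * Real.log 2, ?_⟩
  rintro _ ⟨θ, rfl⟩
  have h1 := cumulant_tangent_le β θ 0
  have h2 : α * Real.binEntropy (cumulantDeriv β θ) ≤ |α| * Real.log 2 :=
    mul_le_mul (le_abs_self α) Real.binEntropy_le_log_two
      (Real.binEntropy_nonneg (cumulantDeriv_pos hβ.le θ).le (cumulantDeriv_lt_one hβ.le θ).le)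
      (abs_nonneg α)
  simp only [exponent]
  linarith

lemma exponent_le_supExponent {β : ℝ} (hβ : 0 < β) (α θ : ℝ) :
    exponent β α θ ≤ supExponent β α :=
  (le_ciSup (bddAbove_exponent hβ α) θ).trans (le_max_right _ _)

lemma logWeightTerm_le {β : ℝ} (hβ : 0 < β) (α : ℝ) {n w : ℕ} (h : w ≤ n) :
    logWeightTerm β α n w ≤ n * supExponent β α + |α| * (2 * (1 + Real.log (1 + n))) := by
  have hp : 0 ≤ Real.log (1 + (n : ℝ)) :=
    Real.log_nonneg (by linarith [(Nat.cast_nonneg n : (0 : ℝ) ≤ n)])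
  have he : 0 ≤ |α| * (2 * (1 + Real.log (1 + n))) := by positivity
  have hs : 0 ≤ n * supExponent β α := mul_nonneg (Nat.cast_nonneg n) (le_max_left _ _)
  -- The weights `0` and `n` need separate treatment, since `cumulantDeriv` takes values in the open
  -- interval `(0, 1)`. Their terms are at most 0, which the maximum with 0 in `supExponent`
  -- absorbs.
  have hedge : n.choose w = 1 → logWeightTerm β α n w ≤
      n * supExponent β α + |α| * (2 * (1 + Real.log (1 + n))) := by
    intro h1
    have h2 := oddsSum_le_choose hβ.le n w
    rw [h1, Nat.cast_one] at h2
    rw [logWeightTerm, h1]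
    simp only [Nat.cast_one, Real.log_one, mul_zero, add_zero]
    linarith [Real.log_nonpos (oddsSum_pos β h).le h2]
  rcases Nat.eq_zero_or_pos w with rfl | hw0
  · exact hedge (by simp)
  rcases h.eq_or_lt with rfl | hwn
  · exact hedge (by simp)
  have hn' : (0 : ℝ) < n := by exact_mod_cast hw0.trans hwn
  -- Saddle point: the tilt whose mean weight is `w` makes the Chernoff bound match the exponent.
  obtain ⟨θ, hθ⟩ := exists_cumulantDeriv_eq hβ (t := (w : ℝ) / n) (by positivity)
    ((div_lt_one hn').2 (by exact_mod_cast hwn))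
  have h1 := log_oddsSum_le β h θ
  have h2 := (logPartition_le hβ.le n θ).1
  have h3 := abs_log_choose_sub_le h
  have h4 : α * Real.log (n.choose w) - α * (n * Real.binEntropy ((w : ℝ) / n)) ≤
      |α| * (2 * (1 + Real.log (1 + n))) := by
    rw [← mul_sub]
    refine (le_abs_self _).trans ?_
    rw [abs_mul]
    exact mul_le_mul_of_nonneg_left h3 (abs_nonneg α)
  have h5 := mul_le_mul_of_nonneg_left (exponent_le_supExponent hβ α θ) hn'.le
  have h6 : n * exponent β α θ =
      n * cumulant β θ - θ * w + α * (n * Real.binEntropy ((w : ℝ) / n)) := by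
    rw [exponent, hθ]
    field_simp
  rw [logWeightTerm]
  linarith

/-- The Chernoff bound at `η` against the near-optimality of `w n` at `θ` bounds `(η - θ) * w n` by
an increment of the log-partition function. Letting `η` approach `θ` from either side squeezes `w n
/ n` to the derivative of the cumulant. -/
lemma tendsto_mode {β : ℝ} (hβ : 0 < β) (θ : ℝ) {w : ℕ → ℕ} (hw : ∀ n, w n ≤ n)
    (h : ∀ n, logPartition β n θ ≤
      Real.log (oddsSum β n (w n)) + θ * w n + Real.log (1 + n)) :
    Tendsto (fun n => (w n : ℝ) / n) atTop (𝓝 (cumulantDeriv β θ)) := by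
  have hc := (continuous_cumulantDeriv hβ).tendsto θ
  have key : ∀ n η, (η - θ) * w n ≤ logPartition β n η - logPartition β n θ +
      Real.log (1 + n) := fun n η => by
    have h1 := log_oddsSum_le β (hw n) η
    have h2 := h n
    linarith
  have hlim : ∀ η : ℝ, Tendsto (fun n : ℕ => (1 / (n : ℝ) * logPartition β n η -
      1 / (n : ℝ) * logPartition β n θ + 1 / (n : ℝ) * (1 * Real.log (1 + n))) / (η - θ)) atTop
      (𝓝 ((cumulant β η - cumulant β θ) / (η - θ))) := fun η => by
    have := (((tendsto_logPartition hβ.le η).sub (tendsto_logPartition hβ.le θ)).add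
      (tendsto_log_one_add_div 1)).div_const (η - θ)
    rwa [add_zero] at this
  refine tendsto_order.2 ⟨fun a ha => ?_, fun b hb => ?_⟩
  · obtain ⟨η, hη, hlt⟩ := ((hc.mono_left nhdsWithin_le_nhds).eventually_const_lt ha |>.and
      self_mem_nhdsWithin).exists (f := 𝓝[<] θ)
    have hlt : η < θ := hlt
    have h1 : a < (cumulant β η - cumulant β θ) / (η - θ) := by
      rw [lt_div_iff_of_neg (by linarith)]
      have := cumulant_tangent_le β η θ
      nlinarith
    filter_upwards [(hlim η).eventually_const_lt h1, eventually_gt_atTop 0] with n hn hn0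
    have hn' : (0 : ℝ) < n := by exact_mod_cast hn0
    refine hn.trans_le ?_
    rw [div_le_iff_of_neg (by linarith)]
    have := mul_le_mul_of_nonneg_left (key n η) (by positivity : (0 : ℝ) ≤ 1 / n)
    calc (w n : ℝ) / n * (η - θ) = 1 / n * ((η - θ) * w n) := by ring
      _ ≤ _ := this
      _ = _ := by ring
  · obtain ⟨η, hη, hlt⟩ := ((hc.mono_left nhdsWithin_le_nhds).eventually_lt_const hb |>.and
      self_mem_nhdsWithin).exists (f := 𝓝[>] θ)
    have hlt : θ < η := hlt
    have h1 : (cumulant β η - cumulant β θ) / (η - θ) < b := by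
      rw [div_lt_iff₀ (by linarith)]
      have := cumulant_tangent_le β η θ
      nlinarith
    filter_upwards [(hlim η).eventually_lt_const h1, eventually_gt_atTop 0] with n hn hn0
    have hn' : (0 : ℝ) < n := by exact_mod_cast hn0
    refine lt_of_le_of_lt ?_ hn
    rw [le_div_iff₀ (by linarith)]
    have := mul_le_mul_of_nonneg_left (key n η) (by positivity : (0 : ℝ) ≤ 1 / n)
    calc (w n : ℝ) / n * (η - θ) = 1 / n * ((η - θ) * w n) := by ring
      _ ≤ _ := this
      _ = _ := by ring

lemma eventually_lt_logWeightSum {β : ℝ} (hβ : 0 < β) {α : ℝ} (hα : -1 < α) (θ : ℝ) {a : ℝ}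
    (ha : a < exponent β α θ) :
    ∀ᶠ n : ℕ in atTop, a < 1 / (n : ℝ) * logWeightSum β α n := by
  choose w hw hmode using fun n => exists_logPartition_le β n θ
  have ht := tendsto_mode hβ θ hw hmode
  have hb := (Real.binEntropy_continuous.tendsto (cumulantDeriv β θ)).comp ht
  have hlim := (((tendsto_logPartition hβ.le θ).sub (ht.const_mul θ)).sub
    (tendsto_log_one_add_div 1)).add ((hb.const_mul α).sub (tendsto_binEntropy_error |α|))
  rw [sub_zero, sub_zero] at hlim
  filter_upwards [hlim.eventually_const_lt ha, eventually_gt_atTop 0] with n hn hn0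
  have hn' : (0 : ℝ) < n := by exact_mod_cast hn0
  refine hn.trans_le ?_
  have h3 := abs_log_choose_sub_le (hw n)
  have h4 : α * (n * Real.binEntropy ((w n : ℝ) / n)) - |α| * (2 * (1 + Real.log (1 + n))) ≤
      α * Real.log (n.choose (w n)) := by
    have : |α * (Real.log (n.choose (w n)) - n * Real.binEntropy ((w n : ℝ) / n))| ≤
        |α| * (2 * (1 + Real.log (1 + n))) := by
      rw [abs_mul]
      exact mul_le_mul_of_nonneg_left h3 (abs_nonneg α)
    linarith [(abs_le.1 this).1]
  have h5 := logWeightTerm_le_logWeightSum β hα (hw n)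
  rw [logWeightTerm] at h5
  have h6 := hmode n
  have h7 : logPartition β n θ - θ * w n - Real.log (1 + n) +
      (α * (n * Real.binEntropy ((w n : ℝ) / n)) - |α| * (2 * (1 + Real.log (1 + n)))) ≤
      logWeightSum β α n := by linarith
  refine le_trans (le_of_eq ?_) (mul_le_mul_of_nonneg_left h7 (by positivity : (0 : ℝ) ≤ 1 / n))
  simp only [Function.comp]
  field_simp

lemma tendsto_logWeightSum {β : ℝ} (hβ : 0 < β) {α : ℝ} (hα : -1 < α) :
    Tendsto (fun n : ℕ => 1 / (n : ℝ) * logWeightSum β α n) atTop (𝓝 (supExponent β α)) := by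
  refine tendsto_order.2 ⟨fun a ha => ?_, fun b hb => ?_⟩
  · rcases lt_max_iff.1 ha with h | h
    -- For `a < 0` the weight `0` alone suffices.
    · refine Eventually.of_forall fun n => h.trans_le (mul_nonneg (by positivity) ?_)
      refine le_trans ?_ (logWeightTerm_le_logWeightSum β hα (Nat.zero_le n))
      rw [logWeightTerm]
      simpa using Real.log_nonneg (one_le_oddsSum_zero β n)
    · obtain ⟨θ, hθ⟩ := exists_lt_of_lt_ciSup h
      exact eventually_lt_logWeightSum hβ hα θ hθ
  · have h1 := ((tendsto_binEntropy_error |α|).add (tendsto_log_one_add_div (1 + α))).const_add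
      (supExponent β α)
    rw [add_zero, add_zero] at h1
    filter_upwards [h1.eventually_lt_const hb, eventually_gt_atTop 0] with n hn hn0
    have hn' : (0 : ℝ) < n := by exact_mod_cast hn0
    refine lt_of_le_of_lt ?_ hn
    have h2 := logWeightSum_le β hα fun w hw => logWeightTerm_le hβ α (n := n) hw
    refine (mul_le_mul_of_nonneg_left h2 (by positivity : (0 : ℝ) ≤ 1 / n)).trans (le_of_eq ?_)
    field_simp
    ring

/-- The scaled cumulant generating function of the hard-decision guesswork process. -/
def hardSCGF (β α : ℝ) : ℝ :=
  if -1 < α then supExponent β α - cumulant β 0 else -cumulant β 0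

lemma isSCGF_hard {β : ℝ} (hβ : 0 < β) {G : (n : ℕ) → (Fin n → Bool) → ℕ}
    (hG : ∀ n, IsOptimalGuessing (hardNoise β (n := n)) (G n)) :
    IsSCGF (fun _ => hardNoise β) (guesswork G) (hardSCGF β) := by
  refine isSCGF_guesswork hG (fun n => hardNoise_pos β) (fun α hα => ?_)
    (fun n => hardNoise_le_hardNoise_zero hβ.le) fun α hα => ?_
  · have hα' : 1 + α ≠ 0 := by linarith
    rw [hardSCGF, if_pos hα]
    refine ((tendsto_logWeightSum hβ hα).sub (tendsto_logPartition hβ.le 0)).congr fun n => ?_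
    rw [sum_hardNoise_rpow β n hα, Real.log_mul
      (Finset.sum_pos (fun _ _ => Real.exp_pos _) ⟨0, by simp⟩).ne' (Real.exp_pos _).ne',
      Real.log_exp]
    simp only [logWeightSum, logWeightTerm]
    field_simp
    ring
  · rw [hardSCGF, if_neg (not_lt.2 hα)]
    simp only [hardNoise_zero, Real.log_exp, mul_neg]
    exact (tendsto_logPartition hβ.le 0).neg

/-- Weak duality: the tangent inequality for the cumulant and `α` times the one for softplus add up,
and the terms in `θ` times the mean weight cancel. The bound is smooth in `α` and sharp at `α = 1`
for the balanced `θ`, so it serves as the majorant `U` of `eq_of_hasDerivAt_rate`. -/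
lemma supExponent_le {β : ℝ} (hβ : 0 < β) {α : ℝ} (hα : 0 < α) (θ : ℝ) :
    supExponent β α ≤ cumulant β θ + α * softplus (-θ / α) := by
  refine max_le ?_ (ciSup_le fun η => ?_)
  · have h1 : 0 ≤ cumulant β θ :=
      intervalIntegral.integral_nonneg zero_le_one fun u _ => (softplus_pos _).le
    have := softplus_pos (-θ / α)
    positivity
  · obtain ⟨v, hv⟩ : cumulantDeriv β η ∈ range Real.sigmoid := by
      rw [Real.range_sigmoid]
      exact ⟨cumulantDeriv_pos hβ.le η, cumulantDeriv_lt_one hβ.le η⟩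
    have h1 := cumulant_tangent_le β η θ
    have h2 := mul_le_mul_of_nonneg_left (softplus_tangent_le v (-θ / α)) hα.le
    have h3 : α * (softplus v + Real.sigmoid v * (-θ / α - v)) =
        α * (softplus v - v * Real.sigmoid v) - θ * Real.sigmoid v := by
      field_simp
      ring
    rw [h3] at h2
    rw [← hv] at h1
    rw [exponent, ← hv, binEntropy_sigmoid]
    linarith

/-- The balance equation is the stationarity condition of `exponent β 1`. Between `0` and `β` the
increasing side passes the value 1/2 while the decreasing side starts at 1/2. -/
lemma exists_balance {β : ℝ} (hβ : 0 < β) :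
    ∃ θ, 0 < θ ∧ cumulantDeriv β θ = Real.sigmoid (-θ) := by
  have h0 : cumulantDeriv β 0 < Real.sigmoid (-0) := by
    have h1 := mul_cumulantDeriv β 0
    have h2 := softplus_tangent_lt (v := 0) (w := 0 - β) (by linarith)
    rw [Real.sigmoid_zero] at h2
    rw [neg_zero, Real.sigmoid_zero]
    refine lt_of_mul_lt_mul_left (a := β) ?_ hβ.le
    linarith
  have h1 : Real.sigmoid (-β) ≤ cumulantDeriv β β := by
    refine le_trans (Real.sigmoid_le ?_) (le_cumulantDeriv hβ.le β)
    linarith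
  have hc : ContinuousOn (fun θ => cumulantDeriv β θ - Real.sigmoid (-θ)) (Icc 0 β) :=
    ((continuous_cumulantDeriv hβ).sub (continuous_sigmoid.comp continuous_neg)).continuousOn
  obtain ⟨θ, hθ, h⟩ := intermediate_value_Icc hβ.le hc
    (show (0 : ℝ) ∈ _ from ⟨by linarith, by linarith⟩)
  have h' : cumulantDeriv β θ = Real.sigmoid (-θ) := by simpa [sub_eq_zero] using h
  refine ⟨θ, lt_of_le_of_ne hθ.1 ?_, h'⟩
  rintro rfl
  linarith

lemma hasDerivAt_exponent {β : ℝ} (hβ : 0 < β) (α θ : ℝ) :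
    HasDerivAt (exponent β α) (β⁻¹ * (Real.sigmoid θ - Real.sigmoid (θ - β)) *
      (α * (Real.log (1 - cumulantDeriv β θ) - Real.log (cumulantDeriv β θ)) - θ)) θ := by
  have h1 := hasDerivAt_cumulant hβ θ
  have h2 := hasDerivAt_cumulantDeriv hβ θ
  have h3 := (Real.hasDerivAt_binEntropy (cumulantDeriv_pos hβ.le θ).ne'
    (cumulantDeriv_lt_one hβ.le θ).ne).comp θ h2
  exact ((h1.sub ((hasDerivAt_id θ).mul h2)).add (h3.const_mul α)).congr_deriv (by
    simp only [id]
    ring)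

section Balance

variable {β θ : ℝ}

lemma exponent_balance (h : cumulantDeriv β θ = Real.sigmoid (-θ)) (α : ℝ) :
    exponent β α θ = cumulant β θ + softplus (-θ) +
      Real.binEntropy (Real.sigmoid (-θ)) * (α - 1) := by
  rw [exponent, h, binEntropy_sigmoid]
  ring

lemma hardSCGF_one (hβ : 0 < β) (h : cumulantDeriv β θ = Real.sigmoid (-θ)) :
    hardSCGF β 1 = cumulant β θ + softplus (-θ) - cumulant β 0 := by
  have h1 := supExponent_le hβ one_pos θ
  have h2 := exponent_le_supExponent hβ 1 θ
  rw [exponent_balance h] at h2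
  rw [div_one] at h1
  rw [hardSCGF, if_pos (by norm_num)]
  linarith

/-- The balanced `θ` as a trial point gives the weak inequality. Equality would make `θ` maximize
`exponent β α`, and stationarity then reads `α * θ = θ`, against `θ > 0` and `α ≠ 1`. -/
lemma hardSCGF_strict_support (hβ : 0 < β) (hθ : 0 < θ)
    (h : cumulantDeriv β θ = Real.sigmoid (-θ)) {α : ℝ} (hα : 0 < α) (h1 : α ≠ 1) :
    hardSCGF β 1 + Real.binEntropy (Real.sigmoid (-θ)) * (α - 1) < hardSCGF β α := by
  rw [hardSCGF_one hβ h, hardSCGF, if_pos (by linarith)]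
  by_contra! hle
  have hmax : IsLocalMax (exponent β α) θ := Eventually.of_forall fun η => by
    have := exponent_le_supExponent hβ α η
    rw [exponent_balance h]
    linarith
  have h2 := hmax.hasDerivAt_eq_zero (hasDerivAt_exponent hβ α θ)
  rw [h, log_one_sub_sigmoid, log_sigmoid] at h2
  have h3 : 0 < Real.sigmoid θ - Real.sigmoid (θ - β) :=
    sub_pos.2 (Real.sigmoid_lt (by linarith))
  have h4 : (α - 1) * θ = 0 := by
    have := (mul_eq_zero.1 h2).resolve_left (mul_pos (inv_pos.2 hβ) h3).ne'
    linarith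
  exact (mul_ne_zero (sub_ne_zero.2 h1) hθ.ne') h4

end Balance

/-! ### Comparison of the two slopes -/

lemma log_le_half_sub_inv {y : ℝ} (hy : 1 ≤ y) : Real.log y ≤ (y - y⁻¹) / 2 := by
  rw [← Real.sinh_log (by linarith)]
  exact Real.self_le_sinh_iff.2 (Real.log_nonneg hy)

lemma log_two_sub_log_one_add_lt {r : ℝ} (h0 : 0 < r) (h1 : r < 1) :
    4 * (1 + r) / (1 + 3 * r) * (Real.log 2 - Real.log (1 + r)) < -Real.log r := by
  -- The difference of the two sides vanishes at 1, so it suffices that it decreases strictly on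
  -- `[r, 1]`.
  set f : ℝ → ℝ := fun x =>
    -Real.log x - 4 * (1 + x) / (1 + 3 * x) * (Real.log 2 - Real.log (1 + x)) with hf
  have hd : ∀ x, 0 < x → HasDerivAt f (-x⁻¹ - (-8 / (1 + 3 * x) ^ 2 *
      (Real.log 2 - Real.log (1 + x)) + 4 * (1 + x) / (1 + 3 * x) * -(1 / (1 + x)))) x := by
    intro x hx
    have d1 : HasDerivAt (fun x : ℝ => 1 + x) 1 x := (hasDerivAt_id x).const_add 1
    have d2 : HasDerivAt (fun x : ℝ => 1 + 3 * x) (3 * 1) x :=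
      ((hasDerivAt_id x).const_mul 3).const_add 1
    have d3 := (d1.log (by positivity)).const_sub (Real.log 2)
    have d4 := (d1.const_mul 4).div d2 (by positivity)
    refine ((Real.hasDerivAt_log hx.ne').neg.sub (d4.mul d3)).congr_deriv ?_
    have : (1 : ℝ) + 3 * x ≠ 0 := by positivity
    congr 3
    field_simp
    ring
  have hanti : StrictAntiOn f (Icc r 1) := by
    refine strictAntiOn_of_deriv_neg (convex_Icc r 1) (fun x hx =>
      (hd x (h0.trans_le hx.1)).continuousAt.continuousWithinAt) fun x hx => ?_
    rw [interior_Icc] at hx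
    have hx0 : 0 < x := h0.trans hx.1
    have hx1 := hx.2
    rw [(hd x hx0).deriv]
    have hlog := log_le_half_sub_inv (y := 2 / (1 + x)) (by rw [le_div_iff₀] <;> linarith)
    rw [Real.log_div (by norm_num) (by positivity), inv_div] at hlog
    -- The right side is exactly the value of `log (2 / (1 + x))` at which the derivative of `f`
    -- would vanish.
    have hb : (2 / (1 + x) - (1 + x) / 2) / 2 < (1 + 3 * x) * (1 - x) / (8 * x) := by
      have e : (1 + 3 * x) * (1 - x) / (8 * x) - (2 / (1 + x) - (1 + x) / 2) / 2 =
          (1 - x) ^ 3 / (8 * x * (1 + x)) := by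
        field_simp
        ring
      have : 0 < (1 - x) ^ 3 / (8 * x * (1 + x)) :=
        div_pos (pow_pos (by linarith) 3) (by positivity)
      linarith
    have hc : 8 / (1 + 3 * x) ^ 2 * (Real.log 2 - Real.log (1 + x)) <
        8 / (1 + 3 * x) ^ 2 * ((1 + 3 * x) * (1 - x) / (8 * x)) :=
      mul_lt_mul_of_pos_left (hlog.trans_lt hb) (by positivity)
    have e : 8 / (1 + 3 * x) ^ 2 * ((1 + 3 * x) * (1 - x) / (8 * x)) =
        x⁻¹ - 4 / (1 + 3 * x) := by
      field_simp
      ring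
    have e2 : 4 * (1 + x) / (1 + 3 * x) * -(1 / (1 + x)) = -(4 / (1 + 3 * x)) := by
      field_simp
    rw [e] at hc
    rw [e2, neg_div, neg_mul]
    linarith
  have h := hanti ⟨le_rfl, h1.le⟩ ⟨h1.le, le_rfl⟩ h1
  have hf1 : f 1 = 0 := by
    simp only [hf]
    norm_num
  rw [hf1] at h
  simp only [hf] at h
  linarith

/-- The opposite inequality bounds `exp θ` above through the closed form of `cumulantDeriv`, hence
bounds `σ(-θ)` below by `(1 + 3r) / (4(1 + r))`. The mean sigmoid is `(log 2 - log (1 + r)) /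
(β/2)`, which is strictly less: a contradiction. -/
lemma cumulantDeriv_half_lt {β θ : ℝ} (hβ : 0 < β)
    (h : cumulantDeriv β θ = Real.sigmoid (-θ)) :
    cumulantDeriv (β / 2) 0 < Real.sigmoid (-θ) := by
  by_contra! hle
  have hb : 0 < β / 2 := by linarith
  have m1 := mul_cumulantDeriv (β / 2) 0
  have m2 := mul_cumulantDeriv β θ
  rw [h] at m2
  set r := Real.exp (0 - β / 2) with hr
  set T := Real.exp θ with hT
  have hr0 : 0 < r := Real.exp_pos _
  have hr1 : r < 1 := Real.exp_lt_one_iff.2 (by linarith)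
  have hT0 : 0 < T := Real.exp_pos _
  have e1 : Real.exp (θ - β) = T * r ^ 2 := by
    rw [hT, hr, ← Real.exp_nat_mul, ← Real.exp_add]
    congr 1
    push_cast
    ring
  have hineq : softplus θ + 2 * softplus (0 - β / 2) ≤
      softplus (θ - β) + 2 * softplus 0 := by nlinarith
  have hexp := Real.exp_le_exp.2 hineq
  rw [Real.exp_add, Real.exp_add, two_mul, two_mul, Real.exp_add, Real.exp_add, exp_softplus,
    exp_softplus, exp_softplus, exp_softplus, e1, Real.exp_zero, ← hr, ← hT] at hexp
  -- `hexp` says `(1 + T)(1 + r)² ≤ 4(1 + T r²)`; both sides of its rearrangement contain the factor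
  -- `1 - r > 0`.
  have hT1 : T * (1 + 3 * r) ≤ 3 + r := by
    have h2 : (1 - r) * (T * (1 + 3 * r)) ≤ (1 - r) * (3 + r) := by nlinarith
    exact le_of_mul_le_mul_left h2 (by linarith)
  have hs : (1 + 3 * r) / (4 * (1 + r)) ≤ Real.sigmoid (-θ) := by
    rw [Real.sigmoid_def, neg_neg, ← hT, ← one_div, div_le_div_iff₀ (by positivity) (by positivity)]
    linarith
  have hk := log_two_sub_log_one_add_lt hr0 hr1
  have hl1 : Real.log r = 0 - β / 2 := Real.log_exp _
  have hl2 : softplus (0 - β / 2) = Real.log (1 + r) := rfl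
  rw [← hl2, ← softplus_zero, ← m1, hl1] at hk
  have h3 := mul_le_mul_of_nonneg_left (hs.trans hle)
    (by positivity : (0 : ℝ) ≤ 4 * (1 + r) / (1 + 3 * r) * (β / 2))
  have e3 : 4 * (1 + r) / (1 + 3 * r) * (β / 2) * ((1 + 3 * r) / (4 * (1 + r))) = β / 2 := by
    field_simp
  rw [e3] at h3
  linarith

lemma meanEntropy_lt {β θ : ℝ} (hβ : 0 < β) (hθ : 0 < θ)
    (h : cumulantDeriv β θ = Real.sigmoid (-θ)) :
    meanEntropy (β / 2) < Real.binEntropy (Real.sigmoid (-θ)) := by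
  -- Integral of the tangent bound for the entropy at `σ(-θ)`, whose slope there is `θ`.
  have h1 : meanEntropy (β / 2) ≤ softplus (-θ) + θ * cumulantDeriv (β / 2) 0 := by
    have hi := (intervalIntegrable_sigmoid (β / 2) 0 0 1).const_mul θ
    have h2 := intervalIntegral.integral_mono_on (zero_le_one' ℝ)
      ((continuous_binEntropy_sigmoid (β / 2)).intervalIntegrable 0 1)
      ((intervalIntegrable_const (c := softplus (-θ))).add hi) fun u _ => by
        rw [binEntropy_sigmoid]
        linarith [softplus_tangent_le (0 - β / 2 * u) (-θ)]
    rw [intervalIntegral.integral_add intervalIntegrable_const hi,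
      intervalIntegral.integral_const_mul] at h2
    simpa [meanEntropy, cumulantDeriv] using h2
  have h2 := mul_lt_mul_of_pos_left (cumulantDeriv_half_lt hβ h) hθ
  rw [binEntropy_sigmoid]
  linarith

lemma hasDerivAt_mul_softplus_neg_div (θ : ℝ) :
    ∃ d, HasDerivAt (fun α : ℝ => α * softplus (-θ / α)) d 1 := by
  have h1 : DifferentiableAt ℝ (fun α : ℝ => -θ / α) 1 := by
    fun_prop (disch := norm_num)
  exact ⟨_, (differentiableAt_id.mul
    ((hasDerivAt_softplus (-θ / 1)).differentiableAt.comp 1 h1)).hasDerivAt⟩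

end LRC

end

/-! ### The critical rates -/

theorem mainTheorem6 (β : ℝ) (hβ : 0 < β)
    (τ : (n : ℕ) → Equiv.Perm (Fin n))
    (GN GZ : (n : ℕ) → (Fin n → Bool) → ℕ)
    (hGN : ∀ n, LRC.IsOptimalGuessing (LRC.softNoise β (τ n)) (GN n))
    (hGZ : ∀ n, LRC.IsOptimalGuessing (LRC.hardNoise β (n := n)) (GZ n)) :
    ∃ ΛN ΛZ : ℝ → ℝ,
      LRC.IsSCGF (fun n => LRC.softNoise β (τ n)) (LRC.guesswork GN) ΛN ∧
      LRC.IsSCGF (fun _ => LRC.hardNoise β) (LRC.guesswork GZ) ΛZ ∧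
      (∀ x ∈ Set.Icc (0 : ℝ) (Real.log 2),
        BddAbove (LRC.legendreSet ΛN x) ∧ BddAbove (LRC.legendreSet ΛZ x)) ∧
      ∃ x ∈ Set.Ioo (0 : ℝ) 1, ∃ y ∈ Set.Ioo (0 : ℝ) 1,
        HasDerivAt (LRC.rateBits ΛN) 1 x ∧
        (∀ x₁ ∈ Set.Ioo (0 : ℝ) 1, HasDerivAt (LRC.rateBits ΛN) 1 x₁ → x₁ = x) ∧
        HasDerivAt (LRC.rateBits ΛZ) 1 y ∧
        (∀ y₁ ∈ Set.Ioo (0 : ℝ) 1, HasDerivAt (LRC.rateBits ΛZ) 1 y₁ → y₁ = y) ∧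
        1 - y < 1 - x := by
  have hN := LRC.isSCGF_soft hβ.le τ hGN
  have hZ := LRC.isSCGF_hard hβ hGZ
  have hbN : ∀ x ∈ Set.Icc (0 : ℝ) (Real.log 2),
      BddAbove (LRC.legendreSet (LRC.softSCGF β) x) := fun x hx =>
    hN.bddAbove_legendreSet hGN (fun n => LRC.exp_neg_le_softNoise hβ.le (τ n)) hx
  have hbZ : ∀ x ∈ Set.Icc (0 : ℝ) (Real.log 2),
      BddAbove (LRC.legendreSet (LRC.hardSCGF β) x) := fun x hx =>
    hZ.bddAbove_legendreSet hGZ (fun n => LRC.exp_neg_le_hardNoise hβ.le) hx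
  have hcN := hN.convexOn fun n => LRC.softNoise_pos β (τ n)
  have hcZ := hZ.convexOn fun n => LRC.hardNoise_pos β
  obtain ⟨θ, hθ, hbal⟩ := LRC.exists_balance hβ
  have hl2 : 0 < Real.log 2 := Real.log_pos (by norm_num)
  set t := Real.sigmoid (-θ) with ht
  have hlt := LRC.meanEntropy_lt hβ hθ hbal
  rw [← ht] at hlt
  have hpos := LRC.meanEntropy_pos (β / 2)
  have ht2 : Real.binEntropy t < Real.log 2 := by
    refine Real.binEntropy_lt_log_two.2 (ne_of_lt ?_)
    rw [ht, ← Real.sigmoid_zero]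
    exact Real.sigmoid_lt (by linarith)
  have hsN := fun (α : ℝ) => LRC.softSCGF_strict_support hβ (α := α)
  have hsZ := fun (α : ℝ) => LRC.hardSCGF_strict_support hβ hθ hbal (α := α)
  have hmem : ∀ z ∈ Set.Ioo (0 : ℝ) 1, z * Real.log 2 ∈ Set.Icc (0 : ℝ) (Real.log 2) :=
    fun z hz => ⟨by nlinarith [hz.1], by nlinarith [hz.2]⟩
  obtain ⟨d, hd⟩ := LRC.hasDerivAt_mul_softplus_neg_div θ
  refine ⟨LRC.softSCGF β, LRC.hardSCGF β, hN, hZ, fun x hx => ⟨hbN x hx, hbZ x hx⟩,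
    LRC.meanEntropy (β / 2) / Real.log 2, ⟨by positivity, (div_lt_one hl2).2 (hlt.trans ht2)⟩,
    Real.binEntropy t / Real.log 2, ⟨div_pos (hpos.trans hlt) hl2, (div_lt_one hl2).2 ht2⟩,
    ?_, ?_, ?_, ?_, ?_⟩
  · rw [LRC.hasDerivAt_rateBits_iff, div_mul_cancel₀ _ hl2.ne']
    exact LRC.hasDerivAt_rate_of_strict_support hcN hsN
  · intro x₁ hx₁ h
    rw [LRC.hasDerivAt_rateBits_iff] at h
    rw [eq_div_iff hl2.ne']
    exact LRC.eq_of_hasDerivAt_rate (convex_Icc _ _) hbN ⟨hpos.le, (hlt.trans ht2).le⟩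
      (hmem x₁ hx₁) (LRC.isMax_of_strict_support hcN hsN)
      (LRC.differentiableAt_softSCGF hβ).hasDerivAt rfl (fun _ _ => le_rfl) h
  · rw [LRC.hasDerivAt_rateBits_iff, div_mul_cancel₀ _ hl2.ne']
    exact LRC.hasDerivAt_rate_of_strict_support hcZ hsZ
  · intro y₁ hy₁ h
    rw [LRC.hasDerivAt_rateBits_iff] at h
    rw [eq_div_iff hl2.ne']
    -- The majorant is the weak duality bound at the balanced `θ`, shifted by the normalization
    -- `cumulant β 0`.
    refine LRC.eq_of_hasDerivAt_rate (convex_Icc _ _) hbZ ⟨(hpos.trans hlt).le, ht2.le⟩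
      (hmem y₁ hy₁) (LRC.isMax_of_strict_support hcZ hsZ)
      ((hd.const_add (LRC.cumulant β θ)).sub_const (LRC.cumulant β 0)) ?_ (fun α hα => ?_) h
    · rw [LRC.hardSCGF_one hβ hbal]
      simp
    · rw [LRC.hardSCGF, if_pos (by linarith)]
      exact sub_le_sub_right (LRC.supExponent_le hβ hα θ) _
  · exact sub_lt_sub_left (div_lt_div_of_pos_right hlt hl2) 1
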